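/- Let $N\ge 0$ be an integer and let $\mathcal J=(\mathcal J_{ijkl})_{1\le i,j,k,l\le N}$ be a real, totally antisymmetric tensor: $\mathcal J_{ijkl}=\mathcal J_{klij}=-\mathcal J_{jikl}=-\mathcal J_{ijlk}=-\mathcal J_{ikjl}$. Let $\psi_{i,\sigma}$ ($1\le i\le N$, $\sigma=\pm$) be anticommuting (Grassmann) variables, and let $d\mu_C$ be the Gaussian Grassmann (Berezin) measure, normalized by $\int d\mu_C=1$, that is proportional to $d\psi\, e^{-\frac12\psi^{T}C^{-1}\psi}$ with covariance $$C_{(i,\sigma),(j,\sigma')}=\delta_{ij}\,\tau_{\sigma\sigma'},\qquad \tau=\begin{pmatrix}0&1\\-1&0\end{pmatrix}.$$ For $u\in\mathbb C$ and anticommuting sources $\eta_{i,\sigma}$ put $$Z(u,\eta)=\int d\mu_C(\psi)\,\exp\Big(-\frac{u}{4!}\sum_{\sigma}\sum_{i,j,k,l}\mathcal J_{ijkl}\,\psi_{i,\sigma}\psi_{j,\sigma}\psi_{k,\sigma}\psi_{l,\sigma}+\sum_{i,\sigma}\eta_{i,\sigma}\psi_{i,\sigma}\Big),\qquad Z(u)=Z(u,0).$$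 The free energy is $F(u)=\log Z(u)$ (principal logarithm; $Z(0)=1$), and the connected correlation functions are $G_{a_1\cdots a_n}(u)=\partial_{\eta_{a_1}}\cdots\partial_{\eta_{a_n}}\log Z(u,\eta)\big|_{\eta=0}$, where the $a_k$ are labels $(i,\sigma)$. Let $\xi_0^2$ be the largest absolute value of an eigenvalue of the real symmetric $N^2\times N^2$ matrix $\mathcal J_{(ij),(kl)}=\mathcal J_{ijkl}$, whose indices are all ordered pairs. Then $Z(u)\neq 0$, and $F$ and all the connected correlation functions are analytic in $u$, in the interior of the cardioid domain $$|u|\le\frac{3}{N\,\xi_0^2}\sqrt{\frac{e}{\pi}}\,\cos^2\Big(\frac{\theta}{2}\Big),\qquad \theta=\arg u$$ (the whole plane if $N\xi_0^2=0$). Moreover $F$ and all the connected correlation functions are Borel summable. Here $f$ is Borel summable if there are complex numbers $a_k$ and constants $R,K,\sigma>0$ such that the following hold. In the disk $\operatorname{Re}(u^{-1})>R^{-1}$, $f$ is analytic and $\big|f(u)-\sum_{k<r}a_ku^k\big|\le K\sigma^r r!\,|u|^r$ for all $r\ge 0$. The Borel transform $\mathcal B(t)=\sum_k a_kt^k/k!$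 converges for $|t|<\sigma^{-1}$ and continues analytically to the set of points at distance less than $\sigma^{-1}$ from $[0,\infty)$. There is a constant $B$ with $|\mathcal B(t)|\le B e^{t/R}$ for $t\ge0$. Finally, in the same disk, $f(u)=\frac1u\int_0^\infty \mathcal B(t)e^{-t/u}\,dt$, and the integral converges absolutely. -/

import Mathlib

open scoped Kronecker Nat

noncomputable section

namespace Majorana

/-- Field modes `(i, s)`: a flavour `i` and a spin `s`, where `0` is spin up and `1` is spin down. -/
abbrev Mode (N : ℕ) : Type := Fin N × Fin 2

/-- The complex Grassmann algebra generated by the fields (`Sum.inl`) and by the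
anticommuting external sources (`Sum.inr`). -/
abbrev Grassmann (N : ℕ) : Type := ExteriorAlgebra ℂ (Mode N ⊕ Mode N → ℂ)

variable {N : ℕ}

/-- The generator of the Grassmann algebra with label `c`. -/
def gen (c : Mode N ⊕ Mode N) : Grassmann N := ExteriorAlgebra.ι ℂ (Pi.single c 1)

/-- The Grassmann field. -/
def psi (a : Mode N) : Grassmann N := gen (Sum.inl a)

/-- The Grassmann source coupled to the field of the same label. -/
def src (a : Mode N) : Grassmann N := gen (Sum.inr a)

/-- The (left) derivative with respect to a generator: the antiderivation which takes the value
`1` on that generator and `0` on all the others. -/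
def gderiv (c : Mode N ⊕ Mode N) : Module.End ℂ (Grassmann N) :=
  CliffordAlgebra.contractLeft (Q := (0 : QuadraticForm ℂ (Mode N ⊕ Mode N → ℂ)))
    (LinearMap.proj c)

/-- The scalar part of an element of the Grassmann algebra. -/
def body : Grassmann N →ₐ[ℂ] ℂ := ExteriorAlgebra.algebraMapInv

/-- The Berezin integral over all the fields (the sources are spectators). -/
def berezin (N : ℕ) : Module.End ℂ (Grassmann N) :=
  ((List.finRange N).map fun i =>
    gderiv (Sum.inl (i, (0 : Fin 2))) * gderiv (Sum.inl (i, (1 : Fin 2)))).prod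

/-- The antisymmetric matrix which couples the two spins. -/
def tau : Matrix (Fin 2) (Fin 2) ℂ := !![0, 1; -1, 0]

/-- The covariance `δ_{ij} τ_{ss'}`. -/
def covariance (N : ℕ) : Matrix (Mode N) (Mode N) ℂ := (1 : Matrix (Fin N) (Fin N) ℂ) ⊗ₖ tau

/-- The kinetic action `½ ψᵀ C⁻¹ ψ`. -/
def kineticAction (N : ℕ) : Grassmann N :=
  (1 / 2 : ℂ) • ∑ a : Mode N, ∑ b : Mode N, (covariance N)⁻¹ a b • (psi a * psi b)

/-- Integration against the normalized Gaussian Grassmann measure of covariance `C`. -/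
def gaussianIntegral (f : Grassmann N) : Grassmann N :=
  (body (berezin N (IsNilpotent.exp (-kineticAction N))))⁻¹ •
    berezin N (IsNilpotent.exp (-kineticAction N) * f)

/-- The symmetries of the coupling tensor: it is totally antisymmetric. -/
def IsFermionicCoupling (J : Fin N → Fin N → Fin N → Fin N → ℝ) : Prop :=
  ∀ i j k l, J i j k l = J k l i j ∧ J i j k l = -J j i k l ∧
    J i j k l = -J i j l k ∧ J i j k l = -J i k j l

/-- The quartic interaction `(u/4!) ∑_s ∑_{ijkl} J_{ijkl} ψ_{i,s} ψ_{j,s} ψ_{k,s} ψ_{l,s}`. -/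
def interaction (J : Fin N → Fin N → Fin N → Fin N → ℝ) (u : ℂ) : Grassmann N :=
  (u / (4 ! : ℂ)) • ∑ s : Fin 2, ∑ i, ∑ j, ∑ k, ∑ l,
    (J i j k l : ℂ) • (psi (i, s) * psi (j, s) * psi (k, s) * psi (l, s))

/-- The coupling of the fields to the sources. -/
def sourceTerm (N : ℕ) : Grassmann N := ∑ a : Mode N, src a * psi a

/-- The partition function. -/
def partitionFunction (J : Fin N → Fin N → Fin N → Fin N → ℝ) (u : ℂ) : ℂ :=
  body (gaussianIntegral (IsNilpotent.exp (-interaction J u)))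

/-- The free energy. As the partition function is `1` at `u = 0`, the principal logarithm is the
branch which vanishes there. -/
def freeEnergy (J : Fin N → Fin N → Fin N → Fin N → ℝ) (u : ℂ) : ℂ :=
  Complex.log (partitionFunction J u)

/-- The partition function with sources, an element of the Grassmann algebra of the sources. -/
def sourcedPartitionFunction (J : Fin N → Fin N → Fin N → Fin N → ℝ) (u : ℂ) : Grassmann N :=
  gaussianIntegral (IsNilpotent.exp (-interaction J u + sourceTerm N))

/-- The logarithm of `z = c (1 + x)` with `c` a non-zero scalar and `x` without scalar part,
`log c + ∑_{k ≥ 1} (-1)^(k+1) x^k / k`. The algebra has `4 N` generators, so that `x ^ k = 0`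
for `k > 4 N` and the series stops. -/
def grassmannLog (z : Grassmann N) : Grassmann N :=
  algebraMap ℂ (Grassmann N) (Complex.log (body z)) +
    ∑ k ∈ Finset.Icc 1 (4 * N), ((-1 : ℂ) ^ (k + 1) / (k : ℂ)) • ((body z)⁻¹ • z - 1) ^ k

/-- The free energy with sources. -/
def sourcedFreeEnergy (J : Fin N → Fin N → Fin N → Fin N → ℝ) (u : ℂ) : Grassmann N :=
  grassmannLog (sourcedPartitionFunction J u)

/-- The connected correlation function with external labels `a 0, …, a (n - 1)`: the derivatives
of the free energy with respect to the sources of these labels, at vanishing sources. -/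
def connectedCorrelation (J : Fin N → Fin N → Fin N → Fin N → ℝ) {n : ℕ} (a : Fin n → Mode N)
    (u : ℂ) : ℂ :=
  body ((List.ofFn fun m => gderiv (Sum.inr (a m))).prod (sourcedFreeEnergy J u))

/-- The coupling tensor as a real symmetric matrix, whose indices are pairs `(i, j)`, `(k, l)`. -/
def couplingMatrix (J : Fin N → Fin N → Fin N → Fin N → ℝ) :
    Matrix (Fin N × Fin N) (Fin N × Fin N) ℝ :=
  Matrix.of fun I L => J I.1 I.2 L.1 L.2

/-- `ξ₀²`: the largest modulus of an eigenvalue of the coupling matrix. -/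
def xiSq (J : Fin N → Fin N → Fin N → Fin N → ℝ) : ℝ :=
  sSup ((fun x : ℝ => |x|) '' spectrum ℝ (couplingMatrix J))

/-- The cardioid `|u| ≤ 3 / (N ξ₀²) √(e/π) cos² (θ/2)` with `θ = arg u`, multiplied out
by `N ξ₀²` (it is the whole plane if `N ξ₀² = 0`). -/
def cardioid (J : Fin N → Fin N → Fin N → Fin N → ℝ) : Set ℂ :=
  {u | (N : ℝ) * xiSq J * ‖u‖ ≤
    3 * Real.sqrt (Real.exp 1 / Real.pi) * Real.cos (Complex.arg u / 2) ^ 2}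

/-- Borel summability of a function `f` of a complex coupling. In a disk `Re (1/z) > 1/R`, `f` is
analytic and has an asymptotic expansion `∑ a_k z^k` at the origin, with remainders of order `r`
bounded by `K σ^r r! |z|^r`. The Borel transform `∑ a_k t^k / k!` converges for `|t| < 1/σ` and
extends analytically to the points at distance less than `1/σ` from the positive axis,
with at most exponential growth `e^{t/R}` on this axis, and `f` is its Laplace transform
`(1/z) ∫₀^∞ 𝓑(t) e^{-t/z} dt` in the disk. -/
def BorelSummable (f : ℂ → ℂ) : Prop :=
  ∃ (a : ℕ → ℂ) (R K σ : ℝ), 0 < R ∧ 0 < K ∧ 0 < σ ∧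
    AnalyticOnNhd ℂ f {z | R⁻¹ < (z⁻¹).re} ∧
    (∀ (r : ℕ) (z : ℂ), R⁻¹ < (z⁻¹).re →
      ‖f z - ∑ k ∈ Finset.range r, a k * z ^ k‖ ≤ K * σ ^ r * (r ! : ℝ) * ‖z‖ ^ r) ∧
    ∃ (𝓑 : ℂ → ℂ) (B : ℝ),
      AnalyticOnNhd ℂ 𝓑 (Metric.thickening σ⁻¹ ((fun t : ℝ => (t : ℂ)) '' Set.Ici 0)) ∧
      (∀ t : ℂ, ‖t‖ < σ⁻¹ → HasSum (fun n : ℕ => a n / (n ! : ℂ) * t ^ n) (𝓑 t)) ∧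
      (∀ t : ℝ, 0 ≤ t → ‖𝓑 t‖ ≤ B * Real.exp (t / R)) ∧
      ∀ z : ℂ, R⁻¹ < (z⁻¹).re →
        MeasureTheory.IntegrableOn (fun t : ℝ => 𝓑 t * Complex.exp (-(t : ℂ) / z))
          (Set.Ioi 0) ∧
        f z = z⁻¹ * ∫ t in Set.Ioi (0 : ℝ), 𝓑 t * Complex.exp (-(t : ℂ) / z)

end Majorana

end

/-!
The partition function of finitely many Grassmann variables is a polynomial in `u`, so the content
of the theorem is that it avoids the closed negative axis, the branch cut of the logarithm. The
spins are coupled only by the covariance, which pairs the fields of spin `0` with those of spin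
`1`. Integration by parts turns the former into derivatives with respect to the latter, which act on
the fermionic Fock space as annihilation operators, while the fields of spin `1` act as creation
operators. Hence (`exists_partitionFunction_eq_sum`)

  `Z(u) = ∑_n (u/24)^(2n) ‖Aⁿ Ω‖² / (n!)²`, with `A = ∑ J_{ijkl} a†_i a†_j a†_k a†_l`

and `Ω` the vacuum. Regarding the coupling as a matrix on pairs, two of the creation operators are
moved to the other side of an inner product, and `‖A v‖ ≤ ξ₀² (k + 4) N ‖v‖` for `v` of degree `k`
(`HasDegree.quarticCreate_dotProduct_le`). The `n`th term of `Z` is therefore at most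
`(N ξ₀² |u| / 6)^(2n)`. As `e < π`, the cardioid lies in the disk `N ξ₀² |u| ≤ 3`, in which
`|Z(u) - 1| ≤ 1/3` (`partitionFunction_re_pos`) and the principal logarithm of `Z` is analytic.
Since `Z` is the scalar part of the partition function with sources (`body_sourcedPartitionFunction`),
whose coefficients are polynomials in `u`, the connected correlation functions are analytic at
the same points.

In particular all these functions are analytic at the origin. This already gives Borel
summability (`borelSummable_of_analyticAt`), because the constants may depend on `N` and on the
coupling: the Borel transform of a convergent series is entire of exponential type.
-/

noncomputable section

namespace Majorana

/-! ### Borel summability of convergent power series -/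

lemma integrableOn_pow_mul_exp_neg {c : ℝ} (hc : 0 < c) (n : ℕ) :
    MeasureTheory.IntegrableOn (fun t : ℝ => t ^ n * Real.exp (-(c * t))) (Set.Ioi 0) := by
  have h := integrableOn_rpow_mul_exp_neg_mul_rpow (p := 1) (s := n) (b := c)
    (by have : (0 : ℝ) ≤ n := n.cast_nonneg
        linarith) one_pos hc
  simpa [neg_mul] using h

lemma integral_pow_mul_exp_neg {c : ℝ} (hc : 0 < c) (n : ℕ) :
    ∫ t in Set.Ioi (0 : ℝ), t ^ n * Real.exp (-(c * t)) = n ! * (c⁻¹) ^ (n + 1) := by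
  have h := Real.integral_rpow_mul_exp_neg_mul_Ioi (a := n + 1) (r := c) (by positivity) hc
  simp only [add_sub_cancel_right, Real.rpow_natCast, Real.Gamma_nat_eq_factorial] at h
  rw [h, mul_comm, one_div]
  norm_cast

lemma norm_pow_mul_cexp_neg {t : ℝ} (ht : 0 < t) (w : ℂ) (n : ℕ) :
    ‖(t : ℂ) ^ n * Complex.exp (-(w * t))‖ = t ^ n * Real.exp (-(w.re * t)) := by
  rw [norm_mul, norm_pow, Complex.norm_real, Complex.norm_exp, Real.norm_of_nonneg ht.le]
  simp

lemma integrableOn_pow_mul_cexp_neg {w : ℂ} (hw : 0 < w.re) (n : ℕ) :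
    MeasureTheory.IntegrableOn (fun t : ℝ => (t : ℂ) ^ n * Complex.exp (-(w * t)))
      (Set.Ioi 0) := by
  refine (integrableOn_pow_mul_exp_neg hw n).mono' ?_ ?_
  · exact (by fun_prop : Continuous fun t : ℝ => (t : ℂ) ^ n * Complex.exp (-(w * t)))
      |>.aestronglyMeasurable
  · filter_upwards [MeasureTheory.ae_restrict_mem measurableSet_Ioi] with t ht
    exact (norm_pow_mul_cexp_neg ht w n).le

lemma tendsto_pow_mul_cexp_neg {w : ℂ} (hw : 0 < w.re) (n : ℕ) :
    Filter.Tendsto (fun t : ℝ => (t : ℂ) ^ n * Complex.exp (-(w * t))) Filter.atTop (nhds 0) := by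
  rw [tendsto_zero_iff_norm_tendsto_zero]
  have h := Real.tendsto_pow_mul_exp_neg_atTop_nhds_zero n
  have h2 := (h.comp (Filter.tendsto_id.const_mul_atTop hw)).const_mul ((w.re ^ n)⁻¹)
  rw [mul_zero] at h2
  refine h2.congr' ?_
  filter_upwards [Filter.eventually_gt_atTop 0] with t ht
  rw [norm_pow_mul_cexp_neg ht]
  simp only [Function.comp, id, mul_pow]
  field_simp

/-- The moments of `t ↦ exp (-w t)` on the half line, for complex `w`. -/
lemma integral_pow_mul_cexp_neg {w : ℂ} (hw : 0 < w.re) (n : ℕ) :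
    ∫ t in Set.Ioi (0 : ℝ), (t : ℂ) ^ n * Complex.exp (-(w * t)) = n ! * (w⁻¹) ^ (n + 1) := by
  have hw0 : w ≠ 0 := by rintro rfl; simp at hw
  have hexp : ∀ t : ℝ, HasDerivAt (fun t : ℝ => Complex.exp (-(w * t)))
      (Complex.exp (-(w * t)) * -(w * 1)) t := fun t =>
    (((hasDerivAt_id t).ofReal_comp).const_mul w).neg.cexp
  induction n with
  | zero =>
    have h := MeasureTheory.integral_Ioi_of_hasDerivAt_of_tendsto'
      (f := fun t : ℝ => Complex.exp (-(w * t)))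
      (f' := fun t : ℝ => Complex.exp (-(w * t)) * -(w * 1)) (a := 0) (m := 0)
      (fun t _ => hexp t)
      (by simpa [MeasureTheory.IntegrableOn] using
        (integrableOn_pow_mul_cexp_neg hw 0).mul_const (-(w * 1)))
      (by simpa using tendsto_pow_mul_cexp_neg hw 0)
    rw [MeasureTheory.integral_mul_const] at h
    simp only [mul_one, Complex.ofReal_zero, mul_zero, neg_zero, Complex.exp_zero, zero_sub,
      mul_neg, neg_inj] at h
    simp only [pow_zero, one_mul, Nat.factorial_zero, Nat.cast_one, zero_add, pow_one]
    exact eq_inv_of_mul_eq_one_left h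
  | succ n ih =>
    have h := MeasureTheory.integral_Ioi_of_hasDerivAt_of_tendsto'
      (f := fun t : ℝ => (t : ℂ) ^ (n + 1) * Complex.exp (-(w * t)))
      (f' := fun t : ℝ => ((n + 1 : ℕ) : ℂ) * ((t : ℂ) ^ n * Complex.exp (-(w * t))) -
        w * ((t : ℂ) ^ (n + 1) * Complex.exp (-(w * t)))) (a := 0) (m := 0)
      (fun t _ => by
        convert! ((hasDerivAt_id t).ofReal_comp.pow (n + 1)).mul (hexp t) using 1
        simp
        ring)
      (((integrableOn_pow_mul_cexp_neg hw n).const_mul _).sub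
        ((integrableOn_pow_mul_cexp_neg hw (n + 1)).const_mul _))
      (tendsto_pow_mul_cexp_neg hw (n + 1))
    rw [MeasureTheory.integral_sub ((integrableOn_pow_mul_cexp_neg hw n).const_mul _)
        ((integrableOn_pow_mul_cexp_neg hw (n + 1)).const_mul _),
      MeasureTheory.integral_const_mul, MeasureTheory.integral_const_mul, ih] at h
    simp only [Complex.ofReal_zero, ne_eq, Nat.add_eq_zero_iff, one_ne_zero, and_false,
      not_false_eq_true, zero_pow, zero_mul, sub_zero] at h
    have h2 := (sub_eq_zero.mp h).symm
    rw [Nat.factorial_succ]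
    rw [← eq_inv_mul_iff_mul_eq₀ hw0] at h2
    rw [h2]
    push_cast
    ring

/-- A function which is analytic at the origin is Borel summable: the Borel transform of its
Taylor series is entire of exponential type, and the series may be integrated term by term
against `exp (-t / z)`. -/
theorem borelSummable_of_analyticAt {f : ℂ → ℂ} (hf : AnalyticAt ℂ f 0) : BorelSummable f := by
  obtain ⟨p, r₀, hp⟩ := hf
  obtain ⟨s, hs0, hs⟩ := ENNReal.lt_iff_exists_nnreal_btwn.mp hp.r_pos
  obtain ⟨C, hC, hCs⟩ := p.norm_mul_pow_le_of_lt_radius (hs.trans_le hp.r_le)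
  have hs0' : (0 : ℝ) < s := by exact_mod_cast hs0
  set a : ℕ → ℂ := p.coeff with ha
  have hab : ∀ n, ‖a n‖ ≤ C * ((s : ℝ)⁻¹) ^ n := fun n => by
    have h := hCs n
    rw [FormalMultilinearSeries.norm_apply_eq_norm_coef] at h
    rw [inv_pow, ← div_eq_mul_inv, le_div_iff₀ (by positivity)]
    exact h
  -- any disk inside the disk of convergence would do
  set R : ℝ := s / 2 with hR
  have hR0 : 0 < R := by positivity
  have hsR : (s : ℝ)⁻¹ = R⁻¹ / 2 := by rw [hR]; field_simp
  have hdisk : ∀ z : ℂ, R⁻¹ < (z⁻¹).re → ‖z‖ < R := fun z hz => by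
    have h1 : R⁻¹ < ‖z‖⁻¹ := by
      rw [← norm_inv]
      exact hz.trans_le (Complex.re_le_norm _)
    exact (inv_lt_inv₀ hR0 (inv_pos.mp ((inv_pos.mpr hR0).trans h1))).mp h1
  have hmem : ∀ z : ℂ, ‖z‖ < R → z ∈ Metric.eball (0 : ℂ) r₀ := fun z hz => by
    refine Metric.eball_subset_eball hs.le ?_
    rw [Metric.eball_coe, mem_ball_zero_iff]
    linarith
  have hsum : ∀ z : ℂ, ‖z‖ < R → HasSum (fun n => a n * z ^ n) (f z) := fun z hz => by
    have h := hp.hasSum (hmem z hz)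
    simpa [FormalMultilinearSeries.apply_eq_pow_smul_coeff, mul_comm] using h
  have hexpsum : ∀ x : ℝ, HasSum (fun n : ℕ => C * ((s : ℝ)⁻¹ * x) ^ n / n !)
      (C * Real.exp (x / s)) := fun x => by
    have h := (NormedSpace.expSeries_div_hasSum_exp ((s : ℝ)⁻¹ * x)).mul_left C
    rw [← Real.exp_eq_exp_ℝ] at h
    simpa only [mul_div_assoc, div_eq_inv_mul x] using h
  have hterm : ∀ (n : ℕ) (t : ℂ), ‖a n / (n ! : ℂ) * t ^ n‖ ≤
      C * ((s : ℝ)⁻¹ * ‖t‖) ^ n / n ! := fun n t => by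
    rw [norm_mul, norm_div, norm_pow, Complex.norm_natCast, mul_pow, div_mul_eq_mul_div,
      ← mul_assoc]
    gcongr
    exact hab n
  set 𝓑 : ℂ → ℂ := fun t => ∑' n : ℕ, a n / (n ! : ℂ) * t ^ n with h𝓑
  have hBsum : ∀ t : ℂ, HasSum (fun n : ℕ => a n / (n ! : ℂ) * t ^ n) (𝓑 t) := fun t =>
    (Summable.of_norm_bounded (hexpsum ‖t‖).summable (hterm · t)).hasSum
  have hBdiff : Differentiable ℂ 𝓑 := fun t => by
    refine (Complex.differentiableOn_tsum_of_summable_norm (u := fun n : ℕ =>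
      C * ((s : ℝ)⁻¹ * (‖t‖ + 1)) ^ n / n !) (U := Metric.ball 0 (‖t‖ + 1))
      (hexpsum _).summable (fun n => by fun_prop) Metric.isOpen_ball (fun n w hw => ?_)
      ).differentiableAt (Metric.isOpen_ball.mem_nhds (by simp))
    refine (hterm n w).trans ?_
    have : ‖w‖ ≤ ‖t‖ + 1 := (mem_ball_zero_iff.mp hw).le
    gcongr
  have hBbound : ∀ t : ℝ, 0 ≤ t → ‖𝓑 t‖ ≤ C * Real.exp (t / s) := fun t ht => by
    have h := tsum_of_norm_bounded (hexpsum ‖(t : ℂ)‖) (hterm · t)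
    rwa [Complex.norm_real, Real.norm_of_nonneg ht] at h
  refine ⟨a, R, 2 * C, (s : ℝ)⁻¹, hR0, by positivity, by positivity, ?_, ?_, 𝓑, C, ?_, ?_, ?_, ?_⟩
  · exact fun z hz => hp.analyticOnNhd z (hmem z (hdisk z hz))
  · intro r z hz
    have hzR := hdisk z hz
    have h1 := (hasSum_nat_add_iff' r).mpr (hsum z hzR)
    have hq : (s : ℝ)⁻¹ * ‖z‖ ≤ 1 / 2 := by
      rw [hsR, div_mul_eq_mul_div, inv_mul_eq_div]
      have := (div_le_one hR0).mpr hzR.le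
      linarith
    have h2 : HasSum (fun n : ℕ => C * ((s : ℝ)⁻¹ * ‖z‖) ^ r * (1 / 2 : ℝ) ^ n)
        (C * ((s : ℝ)⁻¹ * ‖z‖) ^ r * 2) := hasSum_geometric_two.mul_left _
    have h3 := h1.norm_le_of_bounded h2 (fun n => by
      rw [norm_mul, norm_pow]
      calc ‖a (n + r)‖ * ‖z‖ ^ (n + r)
          ≤ C * ((s : ℝ)⁻¹) ^ (n + r) * ‖z‖ ^ (n + r) := by gcongr; exact hab _
        _ = C * ((s : ℝ)⁻¹ * ‖z‖) ^ r * ((s : ℝ)⁻¹ * ‖z‖) ^ n := by ring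
        _ ≤ _ := by gcongr)
    refine h3.trans ?_
    have h4 : (1 : ℝ) ≤ r ! := by exact_mod_cast r.factorial_pos
    calc C * ((s : ℝ)⁻¹ * ‖z‖) ^ r * 2 = 2 * C * (s : ℝ)⁻¹ ^ r * 1 * ‖z‖ ^ r := by ring
      _ ≤ _ := by gcongr
  · exact fun t _ => hBdiff.analyticAt t
  · exact fun t _ => hBsum t
  · intro t ht
    refine (hBbound t ht).trans ?_
    have : R ≤ s := by rw [hR]; linarith
    gcongr
  · intro z hz
    have hzre : 0 < (z⁻¹).re := (inv_pos.mpr hR0).trans hz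
    have hz0 : z ≠ 0 := by rintro rfl; simp at hzre
    have hcongr : ∀ t : ℝ, -(t : ℂ) / z = -(z⁻¹ * t) := fun t => by field_simp
    simp only [hcongr]
    have hint : MeasureTheory.IntegrableOn (fun t : ℝ => 𝓑 t * Complex.exp (-(z⁻¹ * t)))
        (Set.Ioi 0) := by
      have hpos : 0 < (z⁻¹).re - (s : ℝ)⁻¹ := by
        have := inv_pos.mpr hR0
        rw [hsR]
        linarith
      refine ((integrableOn_pow_mul_exp_neg hpos 0).const_mul C).mono' ?_ ?_
      · have := hBdiff.continuous
        exact (by fun_prop : Continuous fun t : ℝ => 𝓑 t * Complex.exp (-(z⁻¹ * t)))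
          |>.aestronglyMeasurable
      · filter_upwards [MeasureTheory.ae_restrict_mem measurableSet_Ioi] with t ht
        have h1 := norm_pow_mul_cexp_neg ht z⁻¹ 0
        rw [pow_zero, one_mul, pow_zero, one_mul] at h1
        rw [norm_mul, h1, pow_zero, one_mul]
        calc ‖𝓑 t‖ * Real.exp (-((z⁻¹).re * t))
            ≤ C * Real.exp (t / s) * Real.exp (-((z⁻¹).re * t)) := by
              gcongr
              exact hBbound t (le_of_lt ht)
          _ = _ := by
              rw [mul_assoc, ← Real.exp_add]
              congr 2
              ring
    refine ⟨hint, ?_⟩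
    have hFint : ∀ n : ℕ, MeasureTheory.IntegrableOn
        (fun t : ℝ => a n / (n ! : ℂ) * (t : ℂ) ^ n * Complex.exp (-(z⁻¹ * t))) (Set.Ioi 0) :=
      fun n => by
        simpa only [mul_assoc, MeasureTheory.IntegrableOn] using
          (integrableOn_pow_mul_cexp_neg hzre n).const_mul
          (a n / (n ! : ℂ))
    have hnorm : ∀ n : ℕ, ∫ t in Set.Ioi (0 : ℝ),
        ‖a n / (n ! : ℂ) * (t : ℂ) ^ n * Complex.exp (-(z⁻¹ * t))‖ =
        ‖a n‖ * ((z⁻¹).re⁻¹) ^ (n + 1) := fun n => by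
      have h : ∀ t ∈ Set.Ioi (0 : ℝ),
          ‖a n / (n ! : ℂ) * (t : ℂ) ^ n * Complex.exp (-(z⁻¹ * t))‖ =
          ‖a n‖ / n ! * (t ^ n * Real.exp (-((z⁻¹).re * t))) := fun t ht => by
        rw [mul_assoc, norm_mul, norm_pow_mul_cexp_neg ht, norm_div, Complex.norm_natCast]
      rw [MeasureTheory.setIntegral_congr_fun measurableSet_Ioi h,
        MeasureTheory.integral_const_mul, integral_pow_mul_exp_neg hzre]
      field_simp
    have hsummable : Summable fun n : ℕ => ∫ t in Set.Ioi (0 : ℝ),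
        ‖a n / (n ! : ℂ) * (t : ℂ) ^ n * Complex.exp (-(z⁻¹ * t))‖ := by
      simp only [hnorm]
      have hq : (z⁻¹).re⁻¹ ≤ R := inv_le_of_inv_le₀ hR0 hz.le
      refine Summable.of_nonneg_of_le (fun n => by positivity) (fun n => ?_)
        (summable_geometric_two.mul_left (C * R))
      calc ‖a n‖ * ((z⁻¹).re⁻¹) ^ (n + 1) ≤ C * ((s : ℝ)⁻¹) ^ n * R ^ (n + 1) := by
            gcongr
            exact hab n
        _ = C * R * (1 / 2) ^ n := by
            rw [hsR, div_pow, inv_pow, one_div_pow]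
            field_simp
            ring
    have h := MeasureTheory.hasSum_integral_of_summable_integral_norm hFint hsummable
    have h5 : ∀ t : ℝ, ∑' n : ℕ, a n / (n ! : ℂ) * (t : ℂ) ^ n * Complex.exp (-(z⁻¹ * t)) =
        𝓑 t * Complex.exp (-(z⁻¹ * t)) := fun t => tsum_mul_right
    simp only [h5] at h
    have h6 : ∀ n : ℕ, ∫ t in Set.Ioi (0 : ℝ),
        a n / (n ! : ℂ) * (t : ℂ) ^ n * Complex.exp (-(z⁻¹ * t)) = z * (a n * z ^ n) :=
      fun n => by
        simp only [mul_assoc]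
        rw [MeasureTheory.integral_const_mul, integral_pow_mul_cexp_neg hzre, inv_inv]
        have : (n ! : ℂ) ≠ 0 := by exact_mod_cast n.factorial_ne_zero
        field_simp
        ring
    simp only [h6] at h
    rw [h.unique ((hsum z (hdisk z hz)).mul_left z), inv_mul_cancel_left₀ hz0]

/-! ### Creation and annihilation operators -/

/-- The real fermionic Fock space over `N` flavours, as the space of coefficient functions in the
orthonormal basis of occupied sets. -/
abbrev Fock (N : ℕ) : Type := Finset (Fin N) → ℝ

/-- The sign picked up when the flavour `i` is moved to its place among the flavours of `S`. -/
def fockSign {N : ℕ} (i : Fin N) (S : Finset (Fin N)) : ℝ := (-1) ^ (S.filter (· < i)).card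

/-- The creation operator of the flavour `i`. -/
def create {N : ℕ} (i : Fin N) : Module.End ℝ (Fock N) where
  toFun v S := if i ∈ S then fockSign i S * v (S.erase i) else 0
  map_add' v w := by
    ext S
    simp only [Pi.add_apply]
    split_ifs <;> ring
  map_smul' c v := by
    ext S
    simp only [Pi.smul_apply, smul_eq_mul, RingHom.id_apply]
    split_ifs <;> ring

/-- The annihilation operator of the flavour `i`. -/
def annih {N : ℕ} (i : Fin N) : Module.End ℝ (Fock N) where
  toFun v S := if i ∈ S then 0 else fockSign i S * v (insert i S)
  map_add' v w := by
    ext S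
    simp only [Pi.add_apply]
    split_ifs <;> ring
  map_smul' c v := by
    ext S
    simp only [Pi.smul_apply, smul_eq_mul, RingHom.id_apply]
    split_ifs <;> ring

/-- The vacuum vector. -/
def vacuum (N : ℕ) : Fock N := Pi.single ∅ 1

section Fock

variable {N : ℕ}

lemma create_apply (i : Fin N) (v : Fock N) (S : Finset (Fin N)) :
    create i v S = if i ∈ S then fockSign i S * v (S.erase i) else 0 := rfl

lemma annih_apply (i : Fin N) (v : Fock N) (S : Finset (Fin N)) :
    annih i v S = if i ∈ S then 0 else fockSign i S * v (insert i S) := rfl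

lemma fockSign_mul_self (i : Fin N) (S : Finset (Fin N)) : fockSign i S * fockSign i S = 1 := by
  rw [fockSign, ← mul_pow]
  norm_num

lemma fockSign_insert (i j : Fin N) {S : Finset (Fin N)} (h : i ∉ S) :
    fockSign j (insert i S) = (if i < j then -1 else 1) * fockSign j S := by
  rw [fockSign, fockSign, Finset.filter_insert]
  split_ifs with hij
  · rw [Finset.card_insert_of_notMem (by simp [h]), pow_succ, mul_comm]
  · rw [one_mul]

lemma fockSign_erase (i j : Fin N) {S : Finset (Fin N)} (h : i ∈ S) :
    fockSign j (S.erase i) = (if i < j then -1 else 1) * fockSign j S := by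
  have h2 := fockSign_insert i j (Finset.notMem_erase i S)
  rw [Finset.insert_erase h] at h2
  rw [h2]
  split_ifs <;> ring

lemma fockSign_insert_self (i : Fin N) {S : Finset (Fin N)} (h : i ∉ S) :
    fockSign i (insert i S) = fockSign i S := by
  simp [fockSign_insert i i h]

lemma fockSign_erase_self (i : Fin N) {S : Finset (Fin N)} (h : i ∈ S) :
    fockSign i (S.erase i) = fockSign i S := by
  simp [fockSign_erase i i h]

lemma annih_create_self (i : Fin N) (v : Fock N) :
    annih i (create i v) + create i (annih i v) = v := by
  ext S
  rw [Pi.add_apply, annih_apply, create_apply, create_apply, annih_apply]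
  by_cases h : i ∈ S
  · simp [h, fockSign_erase_self i h, ← mul_assoc, fockSign_mul_self]
  · simp [h, fockSign_insert_self i h, ← mul_assoc, fockSign_mul_self]

lemma annih_create_of_ne {i j : Fin N} (hij : i ≠ j) (v : Fock N) :
    annih i (create j v) + create j (annih i v) = 0 := by
  ext S
  rw [Pi.add_apply, annih_apply, create_apply, create_apply, annih_apply]
  by_cases hi : i ∈ S
  · simp [hi, hij]
  by_cases hj : j ∈ S
  · have hset : (insert i S).erase j = insert i (S.erase j) :=
      Finset.erase_insert_of_ne hij
    simp only [hi, hj, Finset.mem_erase, Finset.mem_insert, hset, fockSign_insert i j hi,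
      fockSign_erase j i hj, if_true, if_false, or_true, and_false, Pi.zero_apply]
    rcases lt_or_gt_of_ne hij with h | h
    · simp only [h, h.not_gt, if_true, if_false]
      ring
    · simp only [h, h.not_gt, if_true, if_false]
      ring
  · simp [hi, hj, hij.symm]

lemma create_create (i j : Fin N) (v : Fock N) :
    create i (create j v) + create j (create i v) = 0 := by
  ext S
  rw [Pi.add_apply, create_apply, create_apply, create_apply, create_apply]
  by_cases hij : i = j
  · subst hij
    simp
  by_cases hi : i ∈ S
  · by_cases hj : j ∈ S
    · simp only [hi, hj, Ne.symm hij, hij, Finset.mem_erase, ne_eq, not_false_eq_true, and_self,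
        if_true, fockSign_erase i j hi, fockSign_erase j i hj, Pi.zero_apply,
        Finset.erase_right_comm (a := i) (b := j)]
      rcases lt_or_gt_of_ne hij with h | h
      · simp only [h, h.not_gt, if_true, if_false]
        ring
      · simp only [h, h.not_gt, if_true, if_false]
        ring
    · simp [hj]
  · simp [hi]

lemma annih_vacuum (i : Fin N) : annih i (vacuum N) = 0 := by
  ext S
  rw [annih_apply, vacuum]
  split_ifs with h
  · rfl
  · rw [Pi.single_eq_of_ne (Finset.insert_ne_empty i S), mul_zero, Pi.zero_apply]

/-- Summation over the sets which do not contain `i` and over those which do. -/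
lemma sum_notMem_insert (i : Fin N) (f : Finset (Fin N) → ℝ) :
    ∑ S, (if i ∈ S then 0 else f (insert i S)) = ∑ S, if i ∈ S then f S else 0 := by
  have h : ∀ S, (if i ∈ S then 0 else f (insert i S)) =
      if i ∉ S then f (insert i S) else 0 := fun S => by split_ifs <;> rfl
  simp only [h]
  rw [← Finset.sum_filter, ← Finset.sum_filter]
  refine Finset.sum_nbij' (insert i ·) (Finset.erase · i) ?_ ?_ ?_ ?_ ?_
  · simp
  · simp
  · intro S hS
    simp only [Finset.mem_filter] at hS
    exact Finset.erase_insert hS.2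
  · intro S hS
    simp only [Finset.mem_filter] at hS
    exact Finset.insert_erase hS.2
  · simp

/-- The creation and annihilation operators are adjoint to each other. -/
lemma annih_dotProduct (i : Fin N) (v w : Fock N) : annih i v ⬝ᵥ w = v ⬝ᵥ create i w := by
  have h := sum_notMem_insert i fun S => v S * (fockSign i S * w (S.erase i))
  rw [dotProduct, dotProduct]
  convert! h using 2 with S _ S
  · rw [annih_apply]
    split_ifs with hS
    · rw [zero_mul]
    · rw [fockSign_insert_self i hS, Finset.erase_insert hS]
      ring
  · rw [create_apply]
    split_ifs <;> simp

lemma create_dotProduct_self_le (i : Fin N) (v : Fock N) :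
    create i v ⬝ᵥ create i v ≤ v ⬝ᵥ v := by
  have h := sum_notMem_insert i fun S : Finset (Fin N) => v (S.erase i) * v (S.erase i)
  calc create i v ⬝ᵥ create i v =
      ∑ S : Finset (Fin N), if i ∈ S then v (S.erase i) * v (S.erase i) else 0 := by
        refine Finset.sum_congr rfl fun S _ => ?_
        rw [create_apply]
        split_ifs
        · rw [mul_mul_mul_comm, fockSign_mul_self, one_mul]
        · rw [zero_mul]
    _ ≤ v ⬝ᵥ v := by
        rw [← h]
        refine Finset.sum_le_sum fun S _ => ?_
        split_ifs with hS
        · exact mul_self_nonneg _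
        · rw [Finset.erase_insert hS]

/-- The sum of the squared norms of the `annih i v` is the expectation of the particle number. -/
lemma sum_annih_dotProduct_self (v : Fock N) :
    ∑ i, annih i v ⬝ᵥ annih i v = ∑ S, (S.card : ℝ) * (v S * v S) := by
  have h : ∀ i, annih i v ⬝ᵥ annih i v = ∑ S, if i ∈ S then v S * v S else 0 := fun i => by
    rw [← sum_notMem_insert]
    refine Finset.sum_congr rfl fun S _ => ?_
    rw [annih_apply]
    split_ifs
    · rw [zero_mul]
    · rw [mul_mul_mul_comm, fockSign_mul_self, one_mul]
  simp only [h]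
  rw [Finset.sum_comm]
  refine Finset.sum_congr rfl fun S _ => ?_
  rw [← Finset.sum_filter, Finset.sum_const, nsmul_eq_mul, Finset.filter_univ_mem]

/-- A Fock vector of particle number `k`. -/
def HasDegree (k : ℕ) (v : Fock N) : Prop := ∀ S : Finset (Fin N), S.card ≠ k → v S = 0

lemma HasDegree.create {k : ℕ} {v : Fock N} (hv : HasDegree k v) (i : Fin N) :
    HasDegree (k + 1) (create i v) := fun S hS => by
  rw [create_apply]
  split_ifs with h
  · rw [hv, mul_zero]
    have := Finset.card_erase_add_one h
    omega
  · rfl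

lemma HasDegree.annih {k : ℕ} {v : Fock N} (hv : HasDegree (k + 1) v) (i : Fin N) :
    HasDegree k (annih i v) := fun S hS => by
  rw [annih_apply]
  split_ifs with h
  · rfl
  · rw [hv, mul_zero]
    rw [Finset.card_insert_of_notMem h]
    omega

lemma HasDegree.sum_annih {k : ℕ} {v : Fock N} (hv : HasDegree k v) :
    ∑ i, Majorana.annih i v ⬝ᵥ Majorana.annih i v = k * (v ⬝ᵥ v) := by
  rw [sum_annih_dotProduct_self, dotProduct, Finset.mul_sum]
  refine Finset.sum_congr rfl fun S _ => ?_
  by_cases hS : S.card = k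
  · rw [hS]
  · simp [hv S hS]

lemma HasDegree.dotProduct_eq_zero {k l : ℕ} (hkl : k ≠ l) {v w : Fock N} (hv : HasDegree k v)
    (hw : HasDegree l w) : v ⬝ᵥ w = 0 := by
  refine Finset.sum_eq_zero fun S _ => ?_
  by_cases hS : S.card = k
  · rw [hw S (by omega), mul_zero]
  · rw [hv S hS, zero_mul]

lemma hasDegree_vacuum : HasDegree 0 (vacuum N) := fun S hS => by
  rw [vacuum, Pi.single_eq_of_ne]
  rintro rfl
  simp at hS

/-! ### The coupling matrix -/

lemma IsFermionicCoupling.isHermitian {J : Fin N → Fin N → Fin N → Fin N → ℝ}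
    (hJ : IsFermionicCoupling J) : (couplingMatrix J).IsHermitian := by
  ext I L
  exact (hJ L.1 L.2 I.1 I.2).1

lemma abs_le_xiSq (J : Fin N → Fin N → Fin N → Fin N → ℝ) {x : ℝ}
    (hx : x ∈ spectrum ℝ (couplingMatrix J)) : |x| ≤ xiSq J :=
  le_csSup (Matrix.finite_real_spectrum.image _).bddAbove (Set.mem_image_of_mem _ hx)

lemma xiSq_nonneg (J : Fin N → Fin N → Fin N → Fin N → ℝ) : 0 ≤ xiSq J :=
  Real.sSup_nonneg (by rintro _ ⟨x, _, rfl⟩; exact abs_nonneg x)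

/-- `xiSq J` bounds the operator norm of the coupling matrix. -/
lemma couplingMatrix_mulVec_le {J : Fin N → Fin N → Fin N → Fin N → ℝ}
    (hJ : IsFermionicCoupling J) (y : Fin N × Fin N → ℝ) :
    (couplingMatrix J).mulVec y ⬝ᵥ (couplingMatrix J).mulVec y ≤ xiSq J ^ 2 * (y ⬝ᵥ y) := by
  have hM := hJ.isHermitian
  set b := hM.eigenvectorBasis
  have hnorm : ∀ x : Fin N × Fin N → ℝ, x ⬝ᵥ x = ∑ i, (x ⬝ᵥ (b i).ofLp) ^ 2 := fun x => by
    have h := b.sum_sq_norm_inner_right (WithLp.toLp 2 x)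
    rw [EuclideanSpace.norm_sq_eq] at h
    simp only [Real.norm_eq_abs, sq_abs, EuclideanSpace.inner_eq_star_dotProduct,
      star_trivial] at h
    rw [h, dotProduct]
    exact Finset.sum_congr rfl fun i _ => (sq (x i)).symm
  rw [hnorm, hnorm y, Finset.mul_sum]
  refine Finset.sum_le_sum fun i _ => ?_
  have hi : (couplingMatrix J).mulVec y ⬝ᵥ (b i).ofLp =
      hM.eigenvalues i * (y ⬝ᵥ (b i).ofLp) := by
    have h1 : (couplingMatrix J).transpose = couplingMatrix J := by
      simpa [Matrix.conjTranspose_eq_transpose_of_trivial] using hM.eq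
    rw [dotProduct_comm, Matrix.dotProduct_mulVec, ← Matrix.mulVec_transpose, h1,
      hM.mulVec_eigenvectorBasis i, smul_dotProduct, smul_eq_mul, dotProduct_comm]
  rw [hi, mul_pow]
  refine mul_le_mul_of_nonneg_right ?_ (sq_nonneg _)
  rw [← sq_abs]
  exact pow_le_pow_left₀ (abs_nonneg _) (abs_le_xiSq J (hM.eigenvalues_mem_spectrum_real i)) 2

/-! ### The quartic creation operator -/

/-- The quartic creation operator `∑ J_{ijkl} a†_i a†_j a†_k a†_l`. -/
def quarticCreate (J : Fin N → Fin N → Fin N → Fin N → ℝ) : Module.End ℝ (Fock N) :=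
  ∑ i, ∑ j, ∑ k, ∑ l, J i j k l • (create i * create j * create k * create l)

/-- The quartic annihilation operator `∑ J_{ijkl} a_l a_k a_j a_i`. -/
def quarticAnnih (J : Fin N → Fin N → Fin N → Fin N → ℝ) : Module.End ℝ (Fock N) :=
  ∑ i, ∑ j, ∑ k, ∑ l, J i j k l • (annih l * annih k * annih j * annih i)

variable (J : Fin N → Fin N → Fin N → Fin N → ℝ)

lemma quarticCreate_apply (v : Fock N) : quarticCreate J v =
    ∑ i, ∑ j, ∑ k, ∑ l, J i j k l • create i (create j (create k (create l v))) := by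
  simp only [quarticCreate, LinearMap.sum_apply, LinearMap.smul_apply, Module.End.mul_apply]

lemma quarticAnnih_apply (v : Fock N) : quarticAnnih J v =
    ∑ i, ∑ j, ∑ k, ∑ l, J i j k l • annih l (annih k (annih j (annih i v))) := by
  simp only [quarticAnnih, LinearMap.sum_apply, LinearMap.smul_apply, Module.End.mul_apply]

lemma quarticAnnih_dotProduct (v w : Fock N) :
    quarticAnnih J v ⬝ᵥ w = v ⬝ᵥ quarticCreate J w := by
  simp only [quarticCreate_apply, quarticAnnih_apply, sum_dotProduct, dotProduct_sum,
    smul_dotProduct, dotProduct_smul, annih_dotProduct]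

lemma quarticAnnih_pow_dotProduct (n : ℕ) (v w : Fock N) :
    (quarticAnnih J ^ n) v ⬝ᵥ w = v ⬝ᵥ (quarticCreate J ^ n) w := by
  induction n generalizing w with
  | zero => rfl
  | succ n ih =>
    rw [pow_succ', pow_succ, Module.End.mul_apply, Module.End.mul_apply, quarticAnnih_dotProduct,
      ih]

lemma HasDegree.sum {ι : Type*} {s : Finset ι} {k : ℕ} {v : ι → Fock N}
    (h : ∀ i, HasDegree k (v i)) : HasDegree k (∑ i ∈ s, v i) := fun S hS => by
  rw [Finset.sum_apply]
  exact Finset.sum_eq_zero fun i _ => h i S hS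

lemma HasDegree.quarticCreate {k : ℕ} {v : Fock N} (hv : HasDegree k v) :
    HasDegree (k + 4) (quarticCreate J v) := by
  rw [quarticCreate_apply]
  refine .sum fun i => .sum fun j => .sum fun m => .sum fun l => fun S hS => ?_
  rw [Pi.smul_apply, ((((hv.create l).create m).create j).create i) S hS, smul_zero]

variable {J}

/-- On vectors of degree `k`, the quartic creation operator has norm at most `ξ₀² (k + 4) N`.
In `⟨X, ∑ J a† a† a† a† v⟩ = ∑ J_{ijkl} ⟨a_j a_i X, a†_k a†_l v⟩` the coupling acts as a matrix on
pairs; the two annihilation operators cost the particle number of `X`, and the two creation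
operators cost the number of flavours. -/
lemma HasDegree.quarticCreate_dotProduct_le (hJ : IsFermionicCoupling J) {k : ℕ} {v : Fock N}
    (hv : HasDegree k v) :
    Majorana.quarticCreate J v ⬝ᵥ Majorana.quarticCreate J v ≤
      (xiSq J * (k + 4) * N) ^ 2 * (v ⬝ᵥ v) := by
  have hX := hv.quarticCreate J
  set X := Majorana.quarticCreate J v with hXdef
  set x : Finset (Fin N) → Fin N × Fin N → ℝ := fun S I =>
    Majorana.annih I.2 (Majorana.annih I.1 X) S with hx
  set y : Finset (Fin N) → Fin N × Fin N → ℝ := fun S I =>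
    Majorana.create I.1 (Majorana.create I.2 v) S with hy
  have h1 : X ⬝ᵥ X = ∑ S, x S ⬝ᵥ (couplingMatrix J).mulVec (y S) := by
    have hW : ∀ W : Fock N, W ⬝ᵥ X = ∑ i, ∑ j, ∑ m, ∑ l, J i j m l *
        (Majorana.annih j (Majorana.annih i W) ⬝ᵥ
          Majorana.create m (Majorana.create l v)) := fun W => by
      rw [hXdef, quarticCreate_apply]
      simp only [dotProduct_sum, dotProduct_smul, annih_dotProduct, smul_eq_mul]
    rw [hW]
    simp only [dotProduct, Matrix.mulVec, couplingMatrix, Matrix.of_apply, hx, hy,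
      Fintype.sum_prod_type, Finset.mul_sum]
    conv_rhs => rw [Finset.sum_comm]
    refine Finset.sum_congr rfl fun i _ => ?_
    conv_rhs => rw [Finset.sum_comm]
    refine Finset.sum_congr rfl fun j _ => ?_
    conv_rhs => rw [Finset.sum_comm]
    refine Finset.sum_congr rfl fun m _ => ?_
    conv_rhs => rw [Finset.sum_comm]
    refine Finset.sum_congr rfl fun l _ => ?_
    exact Finset.sum_congr rfl fun S _ => by ring
  have hxx : ∑ S, x S ⬝ᵥ x S ≤ (k + 4) ^ 2 * (X ⬝ᵥ X) := by
    have h2 : ∑ S, x S ⬝ᵥ x S = ∑ i, ∑ j, Majorana.annih j (Majorana.annih i X) ⬝ᵥ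
        Majorana.annih j (Majorana.annih i X) := by
      simp only [dotProduct, hx]
      rw [Finset.sum_comm, Fintype.sum_prod_type]
    rw [h2]
    have hX' : HasDegree (k + 3 + 1) X := hX
    simp only [(hX'.annih _).sum_annih]
    rw [← Finset.mul_sum, hX'.sum_annih, ← mul_assoc]
    have h3 : 0 ≤ X ⬝ᵥ X := Finset.sum_nonneg fun S _ => mul_self_nonneg _
    refine mul_le_mul_of_nonneg_right ?_ h3
    push_cast
    nlinarith [(Nat.cast_nonneg k : (0 : ℝ) ≤ k)]
  have hyy : ∑ S, y S ⬝ᵥ y S ≤ N ^ 2 * (v ⬝ᵥ v) := by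
    have h2 : ∑ S, y S ⬝ᵥ y S = ∑ i, ∑ j, Majorana.create i (Majorana.create j v) ⬝ᵥ
        Majorana.create i (Majorana.create j v) := by
      simp only [dotProduct, hy]
      rw [Finset.sum_comm, Fintype.sum_prod_type]
    rw [h2]
    calc _ ≤ ∑ _i : Fin N, ∑ _j : Fin N, v ⬝ᵥ v :=
          Finset.sum_le_sum fun i _ => Finset.sum_le_sum fun j _ =>
            (create_dotProduct_self_le i _).trans (create_dotProduct_self_le j v)
      _ = N ^ 2 * (v ⬝ᵥ v) := by simp; ring
  have hMy : ∑ S, (couplingMatrix J).mulVec (y S) ⬝ᵥ (couplingMatrix J).mulVec (y S) ≤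
      xiSq J ^ 2 * (N ^ 2 * (v ⬝ᵥ v)) := by
    refine le_trans ?_ (mul_le_mul_of_nonneg_left hyy (sq_nonneg _))
    rw [Finset.mul_sum]
    exact Finset.sum_le_sum fun S _ => couplingMatrix_mulVec_le hJ (y S)
  have hcs : (∑ S, x S ⬝ᵥ (couplingMatrix J).mulVec (y S)) ^ 2 ≤ (∑ S, x S ⬝ᵥ x S) *
      ∑ S, (couplingMatrix J).mulVec (y S) ⬝ᵥ (couplingMatrix J).mulVec (y S) := by
    simp only [dotProduct, ← Finset.sum_product']
    have h := Finset.sum_mul_sq_le_sq_mul_sq (Finset.univ ×ˢ Finset.univ)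
      (fun p : Finset (Fin N) × (Fin N × Fin N) => x p.1 p.2)
      (fun p => (couplingMatrix J).mulVec (y p.1) p.2)
    simpa only [sq (x _ _), sq ((couplingMatrix J).mulVec _ _)] using h
  rw [← h1] at hcs
  have hX0 : 0 ≤ X ⬝ᵥ X := Finset.sum_nonneg fun S _ => mul_self_nonneg _
  have hMy0 : 0 ≤ ∑ S, (couplingMatrix J).mulVec (y S) ⬝ᵥ (couplingMatrix J).mulVec (y S) :=
    Finset.sum_nonneg fun S _ => Finset.sum_nonneg fun I _ => mul_self_nonneg _
  have hfin : (X ⬝ᵥ X) * (X ⬝ᵥ X) ≤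
      (X ⬝ᵥ X) * ((xiSq J * (k + 4) * N) ^ 2 * (v ⬝ᵥ v)) := by
    calc (X ⬝ᵥ X) * (X ⬝ᵥ X) = (X ⬝ᵥ X) ^ 2 := (sq _).symm
      _ ≤ _ := hcs
      _ ≤ ((k + 4) ^ 2 * (X ⬝ᵥ X)) * (xiSq J ^ 2 * (N ^ 2 * (v ⬝ᵥ v))) :=
        mul_le_mul hxx hMy hMy0 (by positivity)
      _ = _ := by ring
  rcases hX0.eq_or_lt with h0 | hpos
  · rw [← h0]
    have : 0 ≤ v ⬝ᵥ v := Finset.sum_nonneg fun S _ => mul_self_nonneg _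
    positivity
  · exact le_of_mul_le_mul_left hfin hpos

/-- The state with `n` quadruples of particles created by the coupling. -/
def quarticState (J : Fin N → Fin N → Fin N → Fin N → ℝ) (n : ℕ) : Fock N :=
  (quarticCreate J ^ n) (vacuum N)

variable (J) in
lemma quarticState_succ (n : ℕ) : quarticState J (n + 1) = quarticCreate J (quarticState J n) := by
  rw [quarticState, pow_succ', Module.End.mul_apply, quarticState]

variable (J) in
lemma hasDegree_quarticState (n : ℕ) : HasDegree (4 * n) (quarticState J n) := by
  induction n with
  | zero => exact hasDegree_vacuum
  | succ n ih =>
    rw [quarticState_succ]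
    exact ih.quarticCreate J

lemma quarticState_dotProduct_le (hJ : IsFermionicCoupling J) (n : ℕ) :
    quarticState J n ⬝ᵥ quarticState J n ≤ ((4 * xiSq J * N) ^ n * n !) ^ 2 := by
  induction n with
  | zero => simp [quarticState, vacuum]
  | succ n ih =>
    rw [quarticState_succ]
    refine ((hasDegree_quarticState J n).quarticCreate_dotProduct_le hJ).trans ?_
    refine (mul_le_mul_of_nonneg_left ih (sq_nonneg _)).trans (le_of_eq ?_)
    rw [Nat.factorial_succ]
    push_cast
    ring

end Fock

section GrassmannAlgebra

variable {N : ℕ}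

/-! ### Generators and derivatives of the Grassmann algebra -/

lemma gderiv_ι_mul (c : Mode N ⊕ Mode N) (m : Mode N ⊕ Mode N → ℂ) (x : Grassmann N) :
    gderiv c (ExteriorAlgebra.ι ℂ m * x) = m c • x - ExteriorAlgebra.ι ℂ m * gderiv c x := by
  have h := CliffordAlgebra.contractLeft_ι_mul
    (Q := (0 : QuadraticForm ℂ (Mode N ⊕ Mode N → ℂ))) (LinearMap.proj c) m x
  rw [LinearMap.proj_apply] at h
  exact h

lemma gderiv_gen_mul (c c' : Mode N ⊕ Mode N) (x : Grassmann N) :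
    gderiv c (gen c' * x) = (if c = c' then x else 0) - gen c' * gderiv c x := by
  rw [gen, gderiv_ι_mul, Pi.single_apply]
  split_ifs <;> simp

lemma gderiv_psi_mul (a b : Mode N) (x : Grassmann N) :
    gderiv (Sum.inl a) (psi b * x) = (if a = b then x else 0) - psi b * gderiv (Sum.inl a) x := by
  simp only [psi, gderiv_gen_mul, Sum.inl.injEq]

lemma gderiv_algebraMap (c : Mode N ⊕ Mode N) (r : ℂ) :
    gderiv c (algebraMap ℂ (Grassmann N) r) = 0 :=
  CliffordAlgebra.contractLeft_algebraMap 0 _ r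

lemma gderiv_one (c : Mode N ⊕ Mode N) : gderiv c (1 : Grassmann N) = 0 :=
  CliffordAlgebra.contractLeft_one 0 _

lemma gderiv_gderiv_self (c : Mode N ⊕ Mode N) (x : Grassmann N) :
    gderiv c (gderiv c x) = 0 :=
  CliffordAlgebra.contractLeft_contractLeft _ x

lemma gderiv_gderiv (c c' : Mode N ⊕ Mode N) (x : Grassmann N) :
    gderiv c (gderiv c' x) = -gderiv c' (gderiv c x) :=
  CliffordAlgebra.contractLeft_comm _ _ x

lemma body_ι_mul (m : Mode N ⊕ Mode N → ℂ) (x : Grassmann N) :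
    body (ExteriorAlgebra.ι ℂ m * x) = 0 := by
  have h : body (ExteriorAlgebra.ι ℂ m) = 0 := by
    simp [body, ExteriorAlgebra.algebraMapInv]
  rw [map_mul, h, zero_mul]

lemma body_gen_mul (c : Mode N ⊕ Mode N) (x : Grassmann N) : body (gen c * x) = 0 :=
  body_ι_mul _ x

lemma ι_mul_ι (m m' : Mode N ⊕ Mode N → ℂ) :
    ExteriorAlgebra.ι ℂ m * ExteriorAlgebra.ι ℂ m' =
      -(ExteriorAlgebra.ι ℂ m' * ExteriorAlgebra.ι ℂ m) :=
  eq_neg_of_add_eq_zero_left (ExteriorAlgebra.ι_add_mul_swap m m')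

lemma commute_ι_mul_ι (m m' : Mode N ⊕ Mode N → ℂ) (x : Grassmann N) :
    Commute (ExteriorAlgebra.ι ℂ m * ExteriorAlgebra.ι ℂ m') x := by
  induction x using CliffordAlgebra.left_induction with
  | algebraMap r => exact Algebra.commutes' r _ |>.symm
  | add x y hx hy => exact hx.add_right hy
  | ι_mul x n hx =>
    refine Commute.mul_right ?_ hx
    change _ * ExteriorAlgebra.ι ℂ n = ExteriorAlgebra.ι ℂ n * _
    rw [mul_assoc, ι_mul_ι m' n, mul_neg, ← mul_assoc, ι_mul_ι m n, neg_mul, neg_neg, mul_assoc]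

/-- The elements of the Grassmann algebra which are nilpotent and central. -/
def centralNil (N : ℕ) : Submodule ℂ (Grassmann N) where
  carrier := {x | IsNilpotent x ∧ ∀ y, Commute x y}
  zero_mem' := ⟨IsNilpotent.zero, fun y => Commute.zero_left y⟩
  add_mem' hx hy := ⟨(hx.2 _).isNilpotent_add hx.1 hy.1, fun z => (hx.2 z).add_left (hy.2 z)⟩
  smul_mem' c _ hx := ⟨hx.1.smul c, fun y => (hx.2 y).smul_left c⟩

lemma gen_mul_gen_mem (c c' : Mode N ⊕ Mode N) : gen c * gen c' ∈ centralNil N := by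
  refine ⟨⟨2, ?_⟩, commute_ι_mul_ι _ _⟩
  have h := commute_ι_mul_ι (Pi.single c 1) (Pi.single c' 1) (gen c)
  change gen c * gen c' * gen c = gen c * (gen c * gen c') at h
  have h0 : gen c * gen c = 0 := ExteriorAlgebra.ι_sq_zero _
  rw [sq, ← mul_assoc, h, ← mul_assoc, h0, zero_mul, zero_mul]

lemma mul_mem_centralNil {x y : Grassmann N} (hx : x ∈ centralNil N) (hy : y ∈ centralNil N) :
    x * y ∈ centralNil N :=
  ⟨(hx.2 y).isNilpotent_mul_right hx.1, fun z => (hx.2 z).mul_left (hy.2 z)⟩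

lemma exp_eq_sum_complex {x : Grassmann N} {k : ℕ} (h : x ^ k = 0) :
    IsNilpotent.exp x = ∑ n ∈ Finset.range k, ((n ! : ℂ)⁻¹) • x ^ n := by
  rw [IsNilpotent.exp_eq_sum h]
  refine Finset.sum_congr rfl fun n _ => ?_
  rw [← Rat.cast_smul_eq_qsmul ℂ]
  simp

lemma body_exp {x : Grassmann N} (hx : IsNilpotent x) : body (IsNilpotent.exp x) = 1 := by
  rw [IsNilpotent.map_exp hx, (hx.map body).eq_zero, IsNilpotent.exp_zero]

/-! ### The Gaussian weight -/

/-- The exponent `∑_i ψ_{i,0} ψ_{i,1}` of the Gaussian weight. -/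
def pairing (N : ℕ) : Grassmann N := ∑ i : Fin N, psi (i, 0) * psi (i, 1)

lemma covariance_inv : (covariance N)⁻¹ = (1 : Matrix (Fin N) (Fin N) ℂ) ⊗ₖ (-tau) := by
  refine Matrix.inv_eq_right_inv ?_
  have h : tau * -tau = 1 := by
    ext a b
    fin_cases a <;> fin_cases b <;> simp [tau, Matrix.mul_apply]
  rw [covariance, ← Matrix.mul_kronecker_mul, h, one_mul, Matrix.one_kronecker_one]

lemma psi_mul_psi (a b : Mode N) : psi a * psi b = -(psi b * psi a) := ι_mul_ι _ _

/-- The two orders of the fields of each flavour contribute equally, which cancels the factor `½`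
of the kinetic action. -/
lemma neg_kineticAction : -kineticAction N = pairing N := by
  have h : ∀ a : Mode N, ∑ b : Mode N, (covariance N)⁻¹ a b • (psi a * psi b) =
      ∑ s : Fin 2, (-tau) a.2 s • (psi a * psi (a.1, s)) := fun a => by
    rw [covariance_inv, Fintype.sum_prod_type, Finset.sum_eq_single a.1]
    · simp [Matrix.kroneckerMap_apply]
    · intro j _ hj
      simp [Matrix.kroneckerMap_apply, Matrix.one_apply_ne hj.symm]
    · simp
  rw [kineticAction, pairing]
  simp only [h]
  rw [Fintype.sum_prod_type, ← smul_neg, ← Finset.sum_neg_distrib, Finset.smul_sum]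
  refine Finset.sum_congr rfl fun i _ => ?_
  simp only [Fin.sum_univ_two, tau, Matrix.neg_apply, Matrix.of_apply, Matrix.cons_val',
    Matrix.cons_val_zero, Matrix.cons_val_one, Matrix.cons_val_fin_one, neg_zero, zero_smul,
    zero_add, add_zero, neg_neg, one_smul, neg_smul]
  rw [psi_mul_psi (i, 1) (i, 0), ← neg_add, neg_neg, ← two_smul ℂ, smul_smul]
  norm_num

end GrassmannAlgebra

section GaussianMeasure

variable {N : ℕ}

lemma pairing_mem_centralNil : pairing N ∈ centralNil N :=
  Submodule.sum_mem _ fun _ _ => gen_mul_gen_mem _ _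

lemma gderiv_gen_mul_gen_mul (c a b : Mode N ⊕ Mode N) (x : Grassmann N) :
    gderiv c (gen a * gen b * x) = gderiv c (gen a * gen b) * x + gen a * gen b * gderiv c x := by
  have h := gderiv_gen_mul c b 1
  rw [gderiv_one, mul_zero, sub_zero, mul_one] at h
  rw [mul_assoc, gderiv_gen_mul, gderiv_gen_mul, gderiv_gen_mul, h]
  split_ifs <;> noncomm_ring

lemma gderiv_pairing_mul (c : Mode N ⊕ Mode N) (x : Grassmann N) :
    gderiv c (pairing N * x) = gderiv c (pairing N) * x + pairing N * gderiv c x := by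
  simp only [pairing, Finset.sum_mul, map_sum, ← Finset.sum_add_distrib]
  exact Finset.sum_congr rfl fun i _ => gderiv_gen_mul_gen_mul c _ _ x

lemma gderiv_pairing_pow_mul (c : Mode N ⊕ Mode N) (n : ℕ) (x : Grassmann N) :
    gderiv c (pairing N ^ (n + 1) * x) =
      ((n + 1 : ℕ) : ℂ) • (gderiv c (pairing N) * (pairing N ^ n * x)) +
        pairing N ^ (n + 1) * gderiv c x := by
  induction n generalizing x with
  | zero => simp [gderiv_pairing_mul]
  | succ n ih =>
    have hc := (pairing_mem_centralNil (N := N)).2 (gderiv c (pairing N))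
    rw [pow_succ _ (n + 1), mul_assoc, ih, gderiv_pairing_mul, mul_add, ← mul_assoc _ (pairing N) x,
      ← pow_succ, ← mul_assoc _ (pairing N), ← pow_succ, ← mul_assoc _ (gderiv c (pairing N)) x,
      (hc.pow_left (n + 1)).eq, mul_assoc (gderiv c (pairing N)) _ x, ← add_assoc]
    congr 1
    push_cast
    module

/-- The unnormalized Gaussian weight. -/
def weight (N : ℕ) : Grassmann N := IsNilpotent.exp (-kineticAction N)

lemma weight_eq : weight N = IsNilpotent.exp (pairing N) := by
  rw [weight, neg_kineticAction]

lemma commute_weight (x : Grassmann N) : Commute (weight N) x := by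
  obtain ⟨k, hk⟩ := (pairing_mem_centralNil (N := N)).1
  rw [weight_eq, exp_eq_sum_complex hk]
  exact Commute.sum_left _ _ _ fun n _ =>
    (((pairing_mem_centralNil (N := N)).2 x).pow_left n).smul_left _

/-- The derivative of the Gaussian weight, as for an exponential of an even element. -/
lemma gderiv_weight_mul (c : Mode N ⊕ Mode N) (x : Grassmann N) :
    gderiv c (weight N * x) =
      gderiv c (pairing N) * (weight N * x) + weight N * gderiv c x := by
  obtain ⟨k, hk⟩ := (pairing_mem_centralNil (N := N)).1
  have hk' : pairing N ^ (k + 1) = 0 := by rw [pow_succ, hk, zero_mul]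
  have h : weight N * x = x + ∑ n ∈ Finset.range k,
      (((n + 1) ! : ℂ)⁻¹) • (pairing N ^ (n + 1) * x) := by
    rw [weight_eq, exp_eq_sum_complex hk', Finset.sum_range_succ']
    simp [add_mul, Finset.sum_mul, add_comm]
  have h' : weight N * gderiv c x = gderiv c x + ∑ n ∈ Finset.range k,
      (((n + 1) ! : ℂ)⁻¹) • (pairing N ^ (n + 1) * gderiv c x) := by
    rw [weight_eq, exp_eq_sum_complex hk', Finset.sum_range_succ']
    simp [add_mul, Finset.sum_mul, add_comm]
  have h'' : weight N * x = ∑ n ∈ Finset.range k, ((n ! : ℂ)⁻¹) • (pairing N ^ n * x) := by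
    rw [weight_eq, exp_eq_sum_complex hk]
    simp [Finset.sum_mul]
  conv_lhs => rw [h]
  rw [h', h'', map_add, map_sum, Finset.mul_sum, add_left_comm, ← Finset.sum_add_distrib]
  congr 1
  refine Finset.sum_congr rfl fun n _ => ?_
  rw [map_smul, gderiv_pairing_pow_mul, smul_add, smul_smul, mul_smul_comm]
  congr 2
  rw [Nat.factorial_succ]
  push_cast
  have : ((n : ℂ) + 1) ≠ 0 := by exact_mod_cast n.succ_ne_zero
  field_simp

lemma gderiv_one_pairing (i : Fin N) :
    gderiv (Sum.inl (i, 1)) (pairing N) = -psi (i, 0) := by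
  have h : ∀ j : Fin N, gderiv (Sum.inl (i, 1)) (psi (j, 0) * psi (j, 1)) =
      if i = j then -psi (i, 0) else 0 := fun j => by
    have h1 := gderiv_psi_mul (i, 1) (j, 1) 1
    rw [gderiv_one, mul_zero, sub_zero, mul_one] at h1
    rw [gderiv_psi_mul, h1]
    by_cases hij : i = j <;> simp [hij]
  simp [pairing, h]

lemma gderiv_zero_pairing (i : Fin N) :
    gderiv (Sum.inl (i, 0)) (pairing N) = psi (i, 1) := by
  have h : ∀ j : Fin N, gderiv (Sum.inl (i, 0)) (psi (j, 0) * psi (j, 1)) =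
      if i = j then psi (i, 1) else 0 := fun j => by
    have h1 := gderiv_psi_mul (i, 0) (j, 1) 1
    rw [gderiv_one, mul_zero, sub_zero, mul_one] at h1
    rw [gderiv_psi_mul, h1]
    by_cases hij : i = j <;> simp [hij]
  simp [pairing, h]

/-! ### The Berezin integral and integration by parts -/

/-- The part of the Berezin integral which belongs to the flavour `i`. -/
def flavourDeriv (i : Fin N) : Module.End ℂ (Grassmann N) :=
  gderiv (Sum.inl (i, (0 : Fin 2))) * gderiv (Sum.inl (i, (1 : Fin 2)))

lemma flavourDeriv_apply (i : Fin N) (x : Grassmann N) :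
    flavourDeriv i x = gderiv (Sum.inl (i, 0)) (gderiv (Sum.inl (i, 1)) x) := rfl

lemma berezin_eq : berezin N = ((List.finRange N).map flavourDeriv).prod := rfl

lemma commute_flavourDeriv_gderiv (i : Fin N) (c : Mode N ⊕ Mode N) :
    Commute (flavourDeriv i) (gderiv c) := by
  refine LinearMap.ext fun x => ?_
  simp only [Module.End.mul_apply, flavourDeriv_apply]
  rw [gderiv_gderiv _ c, map_neg, gderiv_gderiv _ c, neg_neg]

lemma prod_flavourDeriv_gderiv {L : List (Fin N)} {a : Mode N} (ha : a.1 ∈ L) (x : Grassmann N) :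
    (L.map flavourDeriv).prod (gderiv (Sum.inl a) x) = 0 := by
  induction L with
  | nil => simp at ha
  | cons j L ih =>
    rw [List.map_cons, List.prod_cons, Module.End.mul_apply]
    by_cases h : a.1 ∈ L
    · rw [ih h, map_zero]
    · have hj : j = a.1 := by
        rcases List.mem_cons.mp ha with h' | h'
        · exact h'.symm
        · exact absurd h' h
      have hc : Commute (L.map flavourDeriv).prod (gderiv (Sum.inl a)) :=
        Commute.list_prod_left _ _ fun y hy => by
          obtain ⟨i, _, rfl⟩ := List.mem_map.mp hy
          exact commute_flavourDeriv_gderiv i _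
      have h2 := LinearMap.congr_fun hc.eq x
      rw [Module.End.mul_apply, Module.End.mul_apply] at h2
      rw [h2, flavourDeriv_apply]
      obtain ⟨i, s⟩ := a
      obtain rfl : j = i := hj
      fin_cases s
      · change gderiv (Sum.inl (j, 0)) (gderiv (Sum.inl (j, 1)) (gderiv (Sum.inl (j, 0)) _)) = 0
        rw [gderiv_gderiv (Sum.inl (j, 1)), map_neg, gderiv_gderiv_self, neg_zero]
      · change gderiv (Sum.inl (j, 0)) (gderiv (Sum.inl (j, 1)) (gderiv (Sum.inl (j, 1)) _)) = 0
        rw [gderiv_gderiv_self, map_zero]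

/-- The Berezin integral of a derivative vanishes. -/
lemma berezin_gderiv (a : Mode N) (x : Grassmann N) : berezin N (gderiv (Sum.inl a) x) = 0 :=
  prod_flavourDeriv_gderiv (List.mem_finRange a.1) x

lemma flavourDeriv_weight (i : Fin N) :
    flavourDeriv i (weight N) = (psi (i, 0) * psi (i, 1) - 1) * weight N := by
  have h1 := gderiv_weight_mul (Sum.inl (i, 1)) (1 : Grassmann N)
  have h0 := gderiv_weight_mul (Sum.inl (i, 0)) (1 : Grassmann N)
  rw [gderiv_one, mul_zero, add_zero, mul_one] at h0 h1
  rw [flavourDeriv_apply, h1, gderiv_one_pairing, neg_mul, map_neg, gderiv_psi_mul, if_pos rfl, h0,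
    gderiv_zero_pairing, sub_mul, one_mul, neg_sub, mul_assoc]

lemma flavourDeriv_psi_mul_psi_mul {i j : Fin N} (hij : i ≠ j) (x : Grassmann N) :
    flavourDeriv i ((psi (j, 0) * psi (j, 1) - 1) * x) =
      (psi (j, 0) * psi (j, 1) - 1) * flavourDeriv i x := by
  have h : flavourDeriv i (psi (j, 0) * psi (j, 1) * x) =
      psi (j, 0) * psi (j, 1) * flavourDeriv i x := by
    simp [flavourDeriv_apply, mul_assoc, gderiv_psi_mul, hij]
  rw [sub_mul, sub_mul, map_sub, h, one_mul, one_mul]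

lemma prod_flavourDeriv_weight {L : List (Fin N)} (hL : L.Nodup) :
    (L.map flavourDeriv).prod (weight N) =
      (L.map fun i => psi (i, 0) * psi (i, 1) - 1).prod * weight N := by
  induction L with
  | nil => simp
  | cons i L ih =>
    rw [List.nodup_cons] at hL
    rw [List.map_cons, List.prod_cons, Module.End.mul_apply, ih hL.2]
    have h : ∀ M : List (Fin N), i ∉ M → ∀ x : Grassmann N,
        flavourDeriv i ((M.map fun i => psi (i, 0) * psi (i, 1) - 1).prod * x) =
        (M.map fun i => psi (i, 0) * psi (i, 1) - 1).prod * flavourDeriv i x := by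
      intro M
      induction M with
      | nil => simp
      | cons j M ihM =>
        intro hM x
        rw [List.mem_cons, not_or] at hM
        rw [List.map_cons, List.prod_cons, mul_assoc, flavourDeriv_psi_mul_psi_mul hM.1,
          ihM hM.2, mul_assoc]
    have hc : Commute (psi (i, 0) * psi (i, 1) - 1)
        (L.map fun i => (psi (i, 0) * psi (i, 1) - 1 : Grassmann N)).prod :=
      ((gen_mul_gen_mem _ _).2 _).sub_left (Commute.one_left _)
    rw [h L hL.1, flavourDeriv_weight, ← mul_assoc, List.map_cons, List.prod_cons, ← hc.eq]

lemma body_psi_mul (a : Mode N) (x : Grassmann N) : body (psi a * x) = 0 := body_gen_mul _ x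

lemma body_weight : body (weight N) = 1 := by
  rw [weight_eq, body_exp (pairing_mem_centralNil).1]

lemma body_berezin_weight : body (berezin N (weight N)) = (-1) ^ N := by
  rw [berezin_eq, prod_flavourDeriv_weight (List.nodup_finRange N), map_mul, body_weight, mul_one,
    map_list_prod, List.map_map]
  have h : (body ∘ fun i : Fin N => (psi (i, 0) * psi (i, 1) - 1 : Grassmann N)) =
      fun _ => (-1 : ℂ) := by
    ext i
    rw [Function.comp_apply, map_sub, body_psi_mul, map_one, zero_sub]
  simp [h]

/-- The scalar part of the Gaussian integral. -/
def expect (N : ℕ) : Grassmann N →ₗ[ℂ] ℂ :=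
  (body (berezin N (weight N)))⁻¹ •
    (body.toLinearMap ∘ₗ berezin N ∘ₗ LinearMap.mulLeft ℂ (weight N))

lemma expect_apply (x : Grassmann N) :
    expect N x = (body (berezin N (weight N)))⁻¹ * body (berezin N (weight N * x)) := rfl

lemma body_gaussianIntegral (x : Grassmann N) : body (gaussianIntegral x) = expect N x := by
  rw [gaussianIntegral, map_smul]
  rfl

lemma expect_one : expect N 1 = 1 := by
  rw [expect_apply, mul_one, inv_mul_cancel₀]
  rw [body_berezin_weight]
  exact pow_ne_zero _ (by norm_num)

/-- Integration by parts for the Gaussian measure. -/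
lemma expect_psi_zero_mul (i : Fin N) (x : Grassmann N) :
    expect N (psi (i, 0) * x) = expect N (gderiv (Sum.inl (i, 1)) x) := by
  have h := berezin_gderiv (i, 1) (weight N * x)
  rw [gderiv_weight_mul, gderiv_one_pairing, ← mul_assoc, neg_mul, ← (commute_weight _).eq,
    neg_mul, map_add, map_neg, mul_assoc, neg_add_eq_zero] at h
  rw [expect_apply, expect_apply, h]

lemma expect_psi_one_mul (i : Fin N) (x : Grassmann N) :
    expect N (psi (i, 1) * x) = -expect N (gderiv (Sum.inl (i, 0)) x) := by
  have h := berezin_gderiv (i, 0) (weight N * x)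
  rw [gderiv_weight_mul, gderiv_zero_pairing, ← mul_assoc, ← (commute_weight _).eq,
    map_add, mul_assoc, add_eq_zero_iff_eq_neg] at h
  rw [expect_apply, expect_apply, h, map_neg, mul_neg]

end GaussianMeasure

section Wick

variable {N : ℕ}

/-! ### The fields of spin `1` and the Fock space -/

/-- The real Grassmann algebra generated by one field for each flavour. -/
abbrev RealGrassmann (N : ℕ) : Type := ExteriorAlgebra ℝ (Fin N → ℝ)

/-- The derivative with respect to the generator of the flavour `i`. -/
def rderiv (i : Fin N) : Module.End ℝ (RealGrassmann N) :=
  CliffordAlgebra.contractLeft (Q := (0 : QuadraticForm ℝ (Fin N → ℝ))) (LinearMap.proj i)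

/-- A real combination of flavours as a combination of the labels of the fields of spin `1`. -/
def spinOneLabel (N : ℕ) : (Fin N → ℝ) →ₗ[ℝ] (Mode N ⊕ Mode N → ℂ) where
  toFun v := Sum.elim (fun a => if a.2 = 1 then (v a.1 : ℂ) else 0) 0
  map_add' v w := by
    ext (a | a)
    · simp only [Sum.elim_inl, Pi.add_apply]
      split_ifs <;> simp
    · simp
  map_smul' c v := by
    ext (a | a)
    · simp only [Sum.elim_inl, Pi.smul_apply]
      split_ifs <;> simp
    · simp

lemma spinOneLabel_apply_one (v : Fin N → ℝ) (i : Fin N) :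
    spinOneLabel N v (Sum.inl (i, 1)) = v i := rfl

lemma spinOneLabel_apply_zero (v : Fin N → ℝ) (i : Fin N) :
    spinOneLabel N v (Sum.inl (i, 0)) = 0 := rfl

lemma spinOneLabel_single (i : Fin N) :
    spinOneLabel N (Pi.single i 1) = Pi.single (Sum.inl (i, 1)) 1 := by
  ext (⟨j, s⟩ | a)
  · by_cases hj : j = i <;> by_cases hs : s = 1 <;>
      simp [spinOneLabel, Pi.single_apply, hj, hs]
  · simp [spinOneLabel]

/-- The field of spin `1` with a given real combination of flavours. -/
def spinOneLinear (N : ℕ) : (Fin N → ℝ) →ₗ[ℝ] Grassmann N :=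
  (ExteriorAlgebra.ι ℂ).restrictScalars ℝ ∘ₗ spinOneLabel N

lemma spinOneLinear_mul_self (v : Fin N → ℝ) : spinOneLinear N v * spinOneLinear N v = 0 :=
  ExteriorAlgebra.ι_sq_zero _

/-- The embedding of the real Grassmann algebra which sends its generators to the fields of
spin `1`. -/
def spinOne (N : ℕ) : RealGrassmann N →ₐ[ℝ] Grassmann N :=
  ExteriorAlgebra.lift ℝ ⟨spinOneLinear N, spinOneLinear_mul_self⟩

lemma spinOne_ι (v : Fin N → ℝ) :
    spinOne N (ExteriorAlgebra.ι ℝ v) = ExteriorAlgebra.ι ℂ (spinOneLabel N v) := by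
  rw [spinOne, ExteriorAlgebra.lift_ι_apply]
  rfl

lemma spinOne_ι_single (i : Fin N) :
    spinOne N (ExteriorAlgebra.ι ℝ (Pi.single i 1)) = psi (i, 1) := by
  rw [spinOne_ι, spinOneLabel_single]
  rfl

lemma spinOne_algebraMap (r : ℝ) :
    spinOne N (algebraMap ℝ (RealGrassmann N) r) = algebraMap ℂ (Grassmann N) r := by
  rw [AlgHom.commutes]
  rfl

lemma spinOne_smul (r : ℝ) (x : RealGrassmann N) :
    spinOne N (r • x) = (r : ℂ) • spinOne N x := by
  rw [Algebra.smul_def, map_mul, spinOne_algebraMap, Algebra.smul_def]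

lemma rderiv_ι_mul (i : Fin N) (v : Fin N → ℝ) (x : RealGrassmann N) :
    rderiv i (ExteriorAlgebra.ι ℝ v * x) = v i • x - ExteriorAlgebra.ι ℝ v * rderiv i x := by
  have h := CliffordAlgebra.contractLeft_ι_mul
    (Q := (0 : QuadraticForm ℝ (Fin N → ℝ))) (LinearMap.proj i) v x
  rw [LinearMap.proj_apply] at h
  exact h

lemma rderiv_algebraMap (i : Fin N) (r : ℝ) :
    rderiv i (algebraMap ℝ (RealGrassmann N) r) = 0 :=
  CliffordAlgebra.contractLeft_algebraMap 0 _ r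

lemma gderiv_spinOne (i : Fin N) (x : RealGrassmann N) :
    gderiv (Sum.inl (i, 1)) (spinOne N x) = spinOne N (rderiv i x) := by
  induction x using CliffordAlgebra.left_induction with
  | algebraMap r =>
    have h := spinOne_algebraMap (N := N) r
    have h' := rderiv_algebraMap i r
    rw [h, h', gderiv_algebraMap, map_zero]
  | add x y hx hy => rw [map_add, map_add, map_add, map_add, hx, hy]
  | ι_mul x v hx =>
    have h' := rderiv_ι_mul i v x
    have h := spinOne_ι v
    have hs := spinOne_smul (v i) x
    rw [h', map_sub, map_mul (spinOne N), map_mul (spinOne N), h, gderiv_ι_mul, hx, hs,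
      spinOneLabel_apply_one]

lemma gderiv_zero_spinOne (i : Fin N) (x : RealGrassmann N) :
    gderiv (Sum.inl (i, 0)) (spinOne N x) = 0 := by
  induction x using CliffordAlgebra.left_induction with
  | algebraMap r =>
    have h := spinOne_algebraMap (N := N) r
    rw [h, gderiv_algebraMap]
  | add x y hx hy => rw [map_add, map_add, hx, hy, add_zero]
  | ι_mul x v hx =>
    have h := spinOne_ι v
    rw [map_mul (spinOne N), h, gderiv_ι_mul, hx, spinOneLabel_apply_zero, zero_smul, mul_zero,
      sub_zero]

lemma ι_spinOneLabel (v : Fin N → ℝ) :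
    (ExteriorAlgebra.ι ℂ (spinOneLabel N v) : Grassmann N) = ∑ i, (v i : ℂ) • psi (i, 1) := by
  have h : spinOneLabel N v = ∑ i : Fin N, (v i : ℂ) • Pi.single (Sum.inl (i, 1)) 1 := by
    ext (⟨j, s⟩ | a)
    · by_cases hs : s = 1 <;>
        simp [spinOneLabel, Pi.single_apply, hs]
    · simp [spinOneLabel]
  rw [h, map_sum]
  exact Finset.sum_congr rfl fun i _ => map_smul _ _ _

/-- The action of the real Grassmann algebra on the Fock space, its generators acting as creation
operators. -/
def fockRep (N : ℕ) : RealGrassmann N →ₐ[ℝ] Module.End ℝ (Fock N) :=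
  ExteriorAlgebra.lift ℝ ⟨Fintype.linearCombination ℝ create, fun v => by
    have h : ∀ i j : Fin N, create i * create j = -(create j * create i) := fun i j =>
      LinearMap.ext fun w => eq_neg_of_add_eq_zero_left (create_create i j w)
    have h2 : (∑ i, v i • create i) * (∑ i, v i • create i) =
        -((∑ i, v i • create i) * (∑ i, v i • create i) : Module.End ℝ (Fock N)) := by
      rw [Finset.sum_mul_sum]
      conv_lhs => rw [Finset.sum_comm]
      rw [← Finset.sum_neg_distrib]
      refine Finset.sum_congr rfl fun i _ => ?_
      rw [← Finset.sum_neg_distrib]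
      refine Finset.sum_congr rfl fun j _ => ?_
      rw [smul_mul_smul_comm, smul_mul_smul_comm, h j i, smul_neg, mul_comm]
    rw [Fintype.linearCombination_apply]
    refine LinearMap.ext fun w => funext fun S => ?_
    have h3 := congrFun (LinearMap.congr_fun h2 w) S
    rw [LinearMap.neg_apply, Pi.neg_apply] at h3
    exact self_eq_neg.mp h3⟩

lemma fockRep_ι (v : Fin N → ℝ) :
    fockRep N (ExteriorAlgebra.ι ℝ v) = ∑ i, v i • create i := by
  rw [fockRep, ExteriorAlgebra.lift_ι_apply, Fintype.linearCombination_apply]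

lemma annih_fockRep_ι (i : Fin N) (v : Fin N → ℝ) (w : Fock N) :
    annih i (fockRep N (ExteriorAlgebra.ι ℝ v) w) =
      v i • w - fockRep N (ExteriorAlgebra.ι ℝ v) (annih i w) := by
  have h : ∀ j, annih i (create j w) = (if i = j then w else 0) - create j (annih i w) :=
    fun j => by
      split_ifs with hij
      · subst hij
        exact eq_sub_of_add_eq (annih_create_self i w)
      · exact eq_sub_of_add_eq (annih_create_of_ne hij w)
  simp [fockRep_ι, LinearMap.sum_apply, h, smul_sub, Finset.sum_sub_distrib]

/-- The Fock vector with the same coefficients as an element of the real Grassmann algebra. -/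
def fockVec (N : ℕ) : RealGrassmann N →ₗ[ℝ] Fock N :=
  LinearMap.applyₗ (vacuum N) ∘ₗ (fockRep N).toLinearMap

lemma fockVec_apply (x : RealGrassmann N) : fockVec N x = fockRep N x (vacuum N) := rfl

lemma fockVec_rderiv (i : Fin N) (x : RealGrassmann N) :
    fockVec N (rderiv i x) = annih i (fockVec N x) := by
  induction x using CliffordAlgebra.left_induction with
  | algebraMap r =>
    have h' := rderiv_algebraMap i r
    rw [h', map_zero, fockVec_apply, AlgHom.commutes, Module.algebraMap_end_apply, map_smul,
      annih_vacuum, smul_zero]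
  | add x y hx hy => rw [map_add, map_add, map_add, map_add, hx, hy]
  | ι_mul x v hx =>
    have h' := rderiv_ι_mul i v x
    have h := annih_fockRep_ι i v (fockVec N x)
    rw [h', map_sub, map_smul, fockVec_apply (_ * _), fockVec_apply (_ * _), map_mul, map_mul,
      Module.End.mul_apply, Module.End.mul_apply, ← fockVec_apply, ← fockVec_apply, hx]
    exact h.symm

/-- On the fields of spin `1` alone, the Gaussian measure is evaluation at the origin, that is the
vacuum component. -/
lemma expect_spinOne (x : RealGrassmann N) :
    expect N (spinOne N x) = ((fockVec N x ⬝ᵥ vacuum N : ℝ) : ℂ) := by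
  induction x using CliffordAlgebra.left_induction with
  | algebraMap r =>
    have h := spinOne_algebraMap (N := N) r
    rw [h, Algebra.algebraMap_eq_smul_one, map_smul, expect_one, fockVec_apply, AlgHom.commutes,
      Module.algebraMap_end_apply]
    simp [vacuum]
  | add x y hx hy =>
    rw [map_add, map_add, map_add, hx, hy, add_dotProduct, Complex.ofReal_add]
  | ι_mul x v hx =>
    have h := spinOne_ι v
    have h2 : expect N (spinOne N (ExteriorAlgebra.ι ℝ v * x)) = 0 := by
      rw [map_mul, h, ι_spinOneLabel, Finset.sum_mul, map_sum]
      refine Finset.sum_eq_zero fun i _ => ?_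
      rw [smul_mul_assoc, map_smul, expect_psi_one_mul, gderiv_zero_spinOne, map_zero, neg_zero,
        smul_zero]
    have h3 : fockVec N (ExteriorAlgebra.ι ℝ v * x) ⬝ᵥ vacuum N = 0 := by
      rw [fockVec_apply, map_mul, fockRep_ι]
      simp [vacuum, create_apply]
    rw [h3, Complex.ofReal_zero]
    exact h2

/-! ### The partition function as a sum of squares -/

variable (J : Fin N → Fin N → Fin N → Fin N → ℝ)

/-- The quartic polynomial of the fields of spin `s`. -/
def quarticField (s : Fin 2) : Grassmann N :=
  ∑ i, ∑ j, ∑ k, ∑ l,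
    (J i j k l : ℂ) • (psi (i, s) * psi (j, s) * psi (k, s) * psi (l, s))

/-- The quartic differential operator in the fields of spin `1`. -/
def quarticDeriv : Module.End ℂ (Grassmann N) :=
  ∑ i, ∑ j, ∑ k, ∑ l, (J i j k l : ℂ) • (gderiv (Sum.inl (l, 1)) * gderiv (Sum.inl (k, 1)) *
    gderiv (Sum.inl (j, 1)) * gderiv (Sum.inl (i, 1)))

lemma quarticDeriv_apply (x : Grassmann N) : quarticDeriv J x =
    ∑ i, ∑ j, ∑ k, ∑ l, (J i j k l : ℂ) • gderiv (Sum.inl (l, 1)) (gderiv (Sum.inl (k, 1))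
      (gderiv (Sum.inl (j, 1)) (gderiv (Sum.inl (i, 1)) x))) := by
  simp only [quarticDeriv, LinearMap.sum_apply, LinearMap.smul_apply, Module.End.mul_apply]

lemma interaction_eq (u : ℂ) :
    interaction J u = (u / 24) • (quarticField J 0 + quarticField J 1) := by
  rw [interaction, Fin.sum_univ_two]
  rfl

lemma quarticField_mem (s : Fin 2) : quarticField J s ∈ centralNil N := by
  refine Submodule.sum_mem _ fun i _ => Submodule.sum_mem _ fun j _ =>
    Submodule.sum_mem _ fun k _ => Submodule.sum_mem _ fun l _ => Submodule.smul_mem _ _ ?_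
  rw [mul_assoc]
  exact mul_mem_centralNil (gen_mul_gen_mem _ _) (gen_mul_gen_mem _ _)

lemma gderiv_one_psi_zero_mul (i j : Fin N) (x : Grassmann N) :
    gderiv (Sum.inl (i, 1)) (psi (j, 0) * x) = -(psi (j, 0) * gderiv (Sum.inl (i, 1)) x) := by
  rw [gderiv_psi_mul, if_neg (by simp), zero_sub]

/-- Integration by parts replaces the four fields of spin `0` by derivatives, in reverse order. -/
lemma expect_quarticField_zero_mul (x : Grassmann N) :
    expect N (quarticField J 0 * x) = expect N (quarticDeriv J x) := by
  simp only [quarticField, quarticDeriv_apply, Finset.sum_mul, map_sum, smul_mul_assoc, map_smul,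
    mul_assoc, expect_psi_zero_mul, gderiv_one_psi_zero_mul, map_neg, neg_neg]

lemma quarticDeriv_quarticField_zero_mul (x : Grassmann N) :
    quarticDeriv J (quarticField J 0 * x) = quarticField J 0 * quarticDeriv J x := by
  have h : ∀ c : Fin N, ∀ y : Grassmann N, gderiv (Sum.inl (c, 1)) (quarticField J 0 * y) =
      quarticField J 0 * gderiv (Sum.inl (c, 1)) y := fun c y => by
    simp only [quarticField, Finset.sum_mul, map_sum, smul_mul_assoc, map_smul,
      mul_assoc, gderiv_one_psi_zero_mul, mul_neg, neg_neg]
  simp only [quarticDeriv_apply, h, Finset.mul_sum, mul_smul_comm]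

lemma expect_quarticField_zero_pow_mul (n : ℕ) (x : Grassmann N) :
    expect N (quarticField J 0 ^ n * x) = expect N ((quarticDeriv J ^ n) x) := by
  induction n generalizing x with
  | zero => simp
  | succ n ih =>
    have h : ∀ (m : ℕ) (y : Grassmann N), quarticDeriv J (quarticField J 0 ^ m * y) =
        quarticField J 0 ^ m * quarticDeriv J y := fun m => by
      induction m with
      | zero => simp
      | succ m ihm =>
        intro y
        rw [pow_succ', mul_assoc, quarticDeriv_quarticField_zero_mul, ihm, mul_assoc]
    rw [pow_succ', mul_assoc, expect_quarticField_zero_mul, h, ih, pow_succ,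
      Module.End.mul_apply]

/-- The quartic polynomial of the generators of the real Grassmann algebra. -/
def realQuartic : RealGrassmann N :=
  ∑ i, ∑ j, ∑ k, ∑ l, J i j k l • (ExteriorAlgebra.ι ℝ (Pi.single i 1) *
    ExteriorAlgebra.ι ℝ (Pi.single j 1) * ExteriorAlgebra.ι ℝ (Pi.single k 1) *
    ExteriorAlgebra.ι ℝ (Pi.single l 1))

/-- The quartic differential operator of the real Grassmann algebra. -/
def realQuarticDeriv : Module.End ℝ (RealGrassmann N) :=
  ∑ i, ∑ j, ∑ k, ∑ l, J i j k l • (rderiv l * rderiv k * rderiv j * rderiv i)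

lemma spinOne_realQuartic : spinOne N (realQuartic J) = quarticField J 1 := by
  simp only [realQuartic, quarticField, map_sum, spinOne_smul, map_mul, spinOne_ι_single]

lemma fockRep_realQuartic : fockRep N (realQuartic J) = quarticCreate J := by
  have h : ∀ i : Fin N, fockRep N (ExteriorAlgebra.ι ℝ (Pi.single i 1)) = create i := fun i => by
    simp [fockRep_ι, Pi.single_apply]
  simp only [realQuartic, quarticCreate, map_sum, map_smul, map_mul, h]

lemma quarticDeriv_spinOne (x : RealGrassmann N) :
    quarticDeriv J (spinOne N x) = spinOne N (realQuarticDeriv J x) := by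
  simp only [quarticDeriv_apply, realQuarticDeriv, LinearMap.sum_apply, LinearMap.smul_apply,
    Module.End.mul_apply, map_sum, spinOne_smul, gderiv_spinOne]

lemma fockVec_realQuarticDeriv (x : RealGrassmann N) :
    fockVec N (realQuarticDeriv J x) = quarticAnnih J (fockVec N x) := by
  simp only [quarticAnnih_apply, realQuarticDeriv, LinearMap.sum_apply, LinearMap.smul_apply,
    Module.End.mul_apply, map_sum, map_smul, fockVec_rderiv]

lemma quarticDeriv_pow_spinOne (n : ℕ) (x : RealGrassmann N) :
    (quarticDeriv J ^ n) (spinOne N x) = spinOne N ((realQuarticDeriv J ^ n) x) := by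
  induction n generalizing x with
  | zero => simp
  | succ n ih =>
    rw [pow_succ, pow_succ, Module.End.mul_apply, Module.End.mul_apply, quarticDeriv_spinOne, ih]

lemma fockVec_realQuarticDeriv_pow (n : ℕ) (x : RealGrassmann N) :
    fockVec N ((realQuarticDeriv J ^ n) x) = (quarticAnnih J ^ n) (fockVec N x) := by
  induction n generalizing x with
  | zero => simp
  | succ n ih =>
    rw [pow_succ, pow_succ, Module.End.mul_apply, Module.End.mul_apply, ih,
      fockVec_realQuarticDeriv]

/-- The moments of the interaction are inner products of Fock vectors: integration by parts turns
the fields of spin `0` into derivatives with respect to those of spin `1`, which act as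
annihilation operators. -/
lemma expect_quarticField_pow_mul_pow (n m : ℕ) :
    expect N (quarticField J 0 ^ n * quarticField J 1 ^ m) =
      ((quarticState J m ⬝ᵥ quarticState J n : ℝ) : ℂ) := by
  have h : fockVec N (realQuartic J ^ m) = quarticState J m := by
    rw [fockVec_apply, map_pow, fockRep_realQuartic, quarticState]
  rw [expect_quarticField_zero_pow_mul, ← spinOne_realQuartic, ← map_pow,
    quarticDeriv_pow_spinOne, expect_spinOne, fockVec_realQuarticDeriv_pow, h,
    quarticAnnih_pow_dotProduct]
  rfl

/-- The partition function is a polynomial in `u ^ 2` with non-negative coefficients. -/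
lemma exists_partitionFunction_eq_sum : ∃ K : ℕ, 0 < K ∧ ∀ u : ℂ, partitionFunction J u =
    ∑ n ∈ Finset.range K, (u / 24) ^ (2 * n) *
      ((quarticState J n ⬝ᵥ quarticState J n / (n ! : ℝ) ^ 2 : ℝ) : ℂ) := by
  obtain ⟨K₀, h₀⟩ := (quarticField_mem J 0).1
  obtain ⟨K₁, h₁⟩ := (quarticField_mem J 1).1
  set K := K₀ + K₁ + 1 with hK
  have hp : ∀ s : Fin 2, ∀ c : ℂ, (c • quarticField J s) ^ K = 0 := fun s c => by
    rw [smul_pow]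
    fin_cases s
    · exact smul_eq_zero_of_right _ (pow_eq_zero_of_le (by omega) h₀)
    · exact smul_eq_zero_of_right _ (pow_eq_zero_of_le (by omega) h₁)
  refine ⟨K, by omega, fun u => ?_⟩
  rw [partitionFunction, body_gaussianIntegral, interaction_eq, ← neg_smul, smul_add,
    IsNilpotent.exp_add_of_commute
      (((quarticField_mem J 0).2 _).smul_left _) ⟨K, hp 0 _⟩ ⟨K, hp 1 _⟩,
    exp_eq_sum_complex (hp 0 _), exp_eq_sum_complex (hp 1 _), Finset.sum_mul_sum, map_sum]
  refine Finset.sum_congr rfl fun n hn => ?_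
  rw [map_sum, Finset.sum_eq_single_of_mem n hn]
  · rw [smul_pow, smul_pow, smul_smul, smul_smul, smul_mul_smul_comm, map_smul,
      expect_quarticField_pow_mul_pow, smul_eq_mul, pow_mul, ← neg_sq, ← pow_mul, two_mul, pow_add]
    push_cast
    ring
  · intro m _ hmn
    rw [smul_pow, smul_pow, smul_smul, smul_smul, smul_mul_smul_comm, map_smul,
      expect_quarticField_pow_mul_pow,
      (hasDegree_quarticState J m).dotProduct_eq_zero (by omega) (hasDegree_quarticState J n),
      Complex.ofReal_zero, smul_zero]

variable {J}

/-- In the disk `N ξ₀² |u| ≤ 3`, the `n`th term of the partition function is at most `(1/4)^n`, so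
that the partition function is at distance at most `1/3` from `1`. -/
lemma partitionFunction_re_pos (hJ : IsFermionicCoupling J) {u : ℂ}
    (hu : N * xiSq J * ‖u‖ ≤ 3) : 0 < (partitionFunction J u).re := by
  obtain ⟨K, hK0, hK⟩ := exists_partitionFunction_eq_sum J
  obtain ⟨K, rfl⟩ : ∃ k, K = k + 1 := ⟨K - 1, by omega⟩
  have hterm : ∀ n : ℕ, ‖(u / 24) ^ (2 * n) *
      ((quarticState J n ⬝ᵥ quarticState J n / (n ! : ℝ) ^ 2 : ℝ) : ℂ)‖ ≤ (1 / 4) ^ n :=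
    fun n => by
      have h0 : 0 ≤ quarticState J n ⬝ᵥ quarticState J n :=
        Finset.sum_nonneg fun S _ => mul_self_nonneg _
      have hξ := xiSq_nonneg J
      have hfac : (0 : ℝ) < n ! := by exact_mod_cast n.factorial_pos
      rw [norm_mul, norm_pow, norm_div, Complex.norm_real, Real.norm_of_nonneg (by positivity),
        Complex.norm_ofNat]
      calc (‖u‖ / 24) ^ (2 * n) * (quarticState J n ⬝ᵥ quarticState J n / (n ! : ℝ) ^ 2)
          ≤ (‖u‖ / 24) ^ (2 * n) * (((4 * xiSq J * N) ^ n * n !) ^ 2 / (n ! : ℝ) ^ 2) := by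
            gcongr
            exact quarticState_dotProduct_le hJ n
        _ = ((N * xiSq J * ‖u‖ / 6) ^ 2) ^ n := by
            rw [mul_pow, mul_div_assoc, div_self (by positivity), mul_one, ← pow_mul, ← pow_mul,
              mul_comm n 2, ← mul_pow]
            congr 1
            ring
        _ ≤ (1 / 4) ^ n := by
            have h1 : N * xiSq J * ‖u‖ / 6 ≤ 1 / 2 := by linarith
            have h2 : 0 ≤ N * xiSq J * ‖u‖ / 6 := by positivity
            refine pow_le_pow_left₀ (sq_nonneg _) ?_ n
            nlinarith
  have hone : ‖partitionFunction J u - 1‖ ≤ 1 / 3 := by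
    rw [hK, Finset.sum_range_succ']
    have h0 : quarticState J 0 ⬝ᵥ quarticState J 0 = 1 := by simp [quarticState, vacuum]
    rw [h0]
    simp only [mul_zero, pow_zero, Nat.factorial_zero, Nat.cast_one, one_pow, div_one,
      Complex.ofReal_one, mul_one, add_sub_cancel_right]
    refine (norm_sum_le_of_le _ fun n _ => hterm (n + 1)).trans ?_
    have hg : HasSum (fun n : ℕ => (1 / 4 : ℝ) ^ (n + 1)) (1 / 3) := by
      have h := (hasSum_geometric_of_lt_one (r := (1 / 4 : ℝ)) (by norm_num)
        (by norm_num)).mul_left (1 / 4)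
      norm_num at h
      simpa [pow_succ'] using h
    exact sum_le_hasSum _ (fun n _ => by positivity) hg
  have h := (Complex.abs_re_le_norm (partitionFunction J u - 1)).trans hone
  rw [Complex.sub_re, Complex.one_re] at h
  linarith [(abs_le.mp h).1]

/-- The cardioid lies in the disk `N ξ₀² |u| ≤ 3`, since `e < π`. -/
lemma norm_le_of_mem_cardioid {u : ℂ} (hu : u ∈ cardioid J) : N * xiSq J * ‖u‖ ≤ 3 := by
  refine le_trans hu ?_
  have h1 : Real.sqrt (Real.exp 1 / Real.pi) ≤ 1 := by
    rw [Real.sqrt_le_one, div_le_one Real.pi_pos]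
    linarith [Real.exp_one_lt_d9, Real.pi_gt_three]
  have h2 : Real.cos (Complex.arg u / 2) ^ 2 ≤ 1 := Real.cos_sq_le_one _
  calc 3 * Real.sqrt (Real.exp 1 / Real.pi) * Real.cos (Complex.arg u / 2) ^ 2
      ≤ 3 * 1 * 1 := by gcongr
    _ = 3 := by norm_num

end Wick

section Sources

variable {N : ℕ}

/-! ### Vanishing sources -/

/-- The algebra morphism which sets the sources to zero. -/
def killSources (N : ℕ) : Grassmann N →ₐ[ℂ] Grassmann N :=
  ExteriorAlgebra.map
    (LinearMap.pi (Sum.elim (fun a => LinearMap.proj (Sum.inl a)) 0) :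
      (Mode N ⊕ Mode N → ℂ) →ₗ[ℂ] (Mode N ⊕ Mode N → ℂ))

lemma killSources_ι (m : Mode N ⊕ Mode N → ℂ) :
    killSources N (ExteriorAlgebra.ι ℂ m) =
      ExteriorAlgebra.ι ℂ (Sum.elim (fun a => m (Sum.inl a)) 0) := by
  rw [killSources, ExteriorAlgebra.map_apply_ι]
  congr 1
  ext (a | a) <;> rfl

lemma killSources_psi (a : Mode N) : killSources N (psi a) = psi a := by
  rw [psi, gen, killSources_ι]
  congr 1
  ext (b | b)
  · rfl
  · simp

lemma killSources_src (a : Mode N) : killSources N (src a) = 0 := by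
  rw [src, gen, killSources_ι]
  convert! map_zero (ExteriorAlgebra.ι ℂ (M := Mode N ⊕ Mode N → ℂ))
  ext (b | b)
  · simp
  · rfl

lemma body_killSources (x : Grassmann N) : body (killSources N x) = body x := by
  induction x using CliffordAlgebra.left_induction with
  | algebraMap r => rw [AlgHom.commutes]
  | add x y hx hy => rw [map_add, map_add, map_add, hx, hy]
  | ι_mul x m hx =>
    have h := killSources_ι m
    have h1 := body_ι_mul m x
    rw [map_mul (killSources N), h, body_ι_mul]
    exact h1.symm

lemma gderiv_killSources (a : Mode N) (x : Grassmann N) :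
    gderiv (Sum.inl a) (killSources N x) = killSources N (gderiv (Sum.inl a) x) := by
  induction x using CliffordAlgebra.left_induction with
  | algebraMap r =>
    have h := gderiv_algebraMap (Sum.inl a) r
    rw [AlgHom.commutes, h, map_zero]
  | add x y hx hy => rw [map_add, map_add, map_add, map_add, hx, hy]
  | ι_mul x m hx =>
    have h := killSources_ι m
    have h1 := gderiv_ι_mul (Sum.inl a) m x
    rw [map_mul (killSources N), h, gderiv_ι_mul, hx, h1, map_sub, map_smul,
      map_mul (killSources N), h, Sum.elim_inl]

lemma berezin_killSources (x : Grassmann N) :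
    berezin N (killSources N x) = killSources N (berezin N x) := by
  have h : ∀ L : List (Fin N), (L.map flavourDeriv).prod (killSources N x) =
      killSources N ((L.map flavourDeriv).prod x) := fun L => by
    induction L with
    | nil => rfl
    | cons i L ih =>
      rw [List.map_cons, List.prod_cons, Module.End.mul_apply, Module.End.mul_apply, ih,
        flavourDeriv_apply, flavourDeriv_apply, gderiv_killSources, gderiv_killSources]
  exact h _

lemma killSources_weight : killSources N (weight N) = weight N := by
  rw [weight_eq, IsNilpotent.map_exp (pairing_mem_centralNil).1]
  simp only [pairing, map_sum, map_mul, killSources_psi]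

lemma expect_killSources (x : Grassmann N) : expect N (killSources N x) = expect N x := by
  rw [expect_apply, expect_apply, ← body_killSources (berezin N (weight N * x)),
    ← berezin_killSources, map_mul (killSources N), killSources_weight]

lemma sourceTerm_mem : sourceTerm N ∈ centralNil N :=
  Submodule.sum_mem _ fun _ _ => gen_mul_gen_mem _ _

variable (J : Fin N → Fin N → Fin N → Fin N → ℝ)

lemma neg_interaction_mem (u : ℂ) : -interaction J u ∈ centralNil N := by
  rw [interaction_eq]
  exact Submodule.neg_mem _ (Submodule.smul_mem _ _
    (Submodule.add_mem _ (quarticField_mem J 0) (quarticField_mem J 1)))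

lemma body_sourcedPartitionFunction (u : ℂ) :
    body (sourcedPartitionFunction J u) = partitionFunction J u := by
  have h : killSources N (-interaction J u + sourceTerm N) = -interaction J u := by
    simp only [interaction_eq, quarticField, sourceTerm, map_add, map_neg, map_smul, map_sum,
      map_mul, killSources_psi, killSources_src, zero_mul, Finset.sum_const_zero, add_zero]
  rw [sourcedPartitionFunction, partitionFunction, body_gaussianIntegral, body_gaussianIntegral,
    ← expect_killSources, IsNilpotent.map_exp, h]
  exact (Submodule.add_mem _ (neg_interaction_mem J u) sourceTerm_mem).1

/-! ### Analytic families in the Grassmann algebra -/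

/-- The families of elements of the Grassmann algebra which are analytic at `u₀`, as the finite
sums of constant elements with analytic coefficients. -/
def analyticFamily (N : ℕ) (u₀ : ℂ) : Submodule ℂ (ℂ → Grassmann N) :=
  Submodule.span ℂ {g | ∃ (f : ℂ → ℂ) (x : Grassmann N), AnalyticAt ℂ f u₀ ∧
    g = fun u => f u • x}

variable {u₀ : ℂ}

lemma smul_mem_analyticFamily {f : ℂ → ℂ} (hf : AnalyticAt ℂ f u₀) (x : Grassmann N) :
    (fun u => f u • x) ∈ analyticFamily N u₀ :=
  Submodule.subset_span ⟨f, x, hf, rfl⟩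

lemma const_mem_analyticFamily (x : Grassmann N) : (fun _ => x) ∈ analyticFamily N u₀ := by
  simpa using smul_mem_analyticFamily (u₀ := u₀) (analyticAt_const (v := (1 : ℂ))) x

lemma mul_mem_analyticFamily {g h : ℂ → Grassmann N} (hg : g ∈ analyticFamily N u₀)
    (hh : h ∈ analyticFamily N u₀) : g * h ∈ analyticFamily N u₀ := by
  have hmul := Submodule.mul_mem_mul hg hh
  rw [analyticFamily, Submodule.span_mul_span] at hmul
  refine Submodule.span_mono ?_ hmul
  rintro _ ⟨_, ⟨f, x, hf, rfl⟩, _, ⟨f', x', hf', rfl⟩, rfl⟩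
  refine ⟨f * f', x * x', hf.mul hf', ?_⟩
  ext u
  simp only [Pi.mul_apply, smul_mul_smul_comm]

lemma pow_mem_analyticFamily {g : ℂ → Grassmann N} (hg : g ∈ analyticFamily N u₀) (n : ℕ) :
    g ^ n ∈ analyticFamily N u₀ := by
  induction n with
  | zero =>
    rw [pow_zero]
    exact const_mem_analyticFamily 1
  | succ n ih =>
    rw [pow_succ]
    exact mul_mem_analyticFamily ih hg

lemma fun_smul_mem_analyticFamily {f : ℂ → ℂ} (hf : AnalyticAt ℂ f u₀) {g : ℂ → Grassmann N}
    (hg : g ∈ analyticFamily N u₀) : (fun u => f u • g u) ∈ analyticFamily N u₀ := by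
  have h := mul_mem_analyticFamily (smul_mem_analyticFamily hf (1 : Grassmann N)) hg
  convert! h using 1
  ext u
  simp

lemma map_mem_analyticFamily (T : Module.End ℂ (Grassmann N)) {g : ℂ → Grassmann N}
    (hg : g ∈ analyticFamily N u₀) : (fun u => T (g u)) ∈ analyticFamily N u₀ := by
  induction hg using Submodule.span_induction with
  | mem g hg =>
    obtain ⟨f, x, hf, rfl⟩ := hg
    simpa only [map_smul] using smul_mem_analyticFamily hf (T x)
  | zero =>
    simp only [Pi.zero_apply, map_zero]
    exact (analyticFamily N u₀).zero_mem
  | add g h _ _ hg hh =>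
    simp only [Pi.add_apply, map_add]
    exact (analyticFamily N u₀).add_mem hg hh
  | smul c g _ hg =>
    simp only [Pi.smul_apply, map_smul]
    exact (analyticFamily N u₀).smul_mem c hg

lemma analyticAt_of_mem_analyticFamily (T : Grassmann N →ₗ[ℂ] ℂ) {g : ℂ → Grassmann N}
    (hg : g ∈ analyticFamily N u₀) : AnalyticAt ℂ (fun u => T (g u)) u₀ := by
  induction hg using Submodule.span_induction with
  | mem g hg =>
    obtain ⟨f, x, hf, rfl⟩ := hg
    simp only [map_smul, smul_eq_mul]
    exact hf.mul analyticAt_const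
  | zero => simpa only [Pi.zero_apply, map_zero] using analyticAt_const
  | add g h _ _ hg hh =>
    simp only [Pi.add_apply, map_add]
    exact hg.add hh
  | smul c g _ hg =>
    simp only [Pi.smul_apply, map_smul, smul_eq_mul]
    exact analyticAt_const.mul hg

lemma sourcedPartitionFunction_mem : sourcedPartitionFunction J ∈ analyticFamily N u₀ := by
  set Q := quarticField J 0 + quarticField J 1 with hQ
  have hQmem : Q ∈ centralNil N :=
    Submodule.add_mem _ (quarticField_mem J 0) (quarticField_mem J 1)
  obtain ⟨k, hk⟩ := hQmem.1
  have hexp : ∀ u : ℂ, IsNilpotent.exp (-interaction J u + sourceTerm N) =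
      (∑ n ∈ Finset.range k, ((n ! : ℂ)⁻¹ * (-(u / 24)) ^ n) • Q ^ n) *
        IsNilpotent.exp (sourceTerm N) := fun u => by
    rw [IsNilpotent.exp_add_of_commute ((neg_interaction_mem J u).2 _)
      (neg_interaction_mem J u).1 sourceTerm_mem.1, interaction_eq, ← hQ, ← neg_smul,
      exp_eq_sum_complex (k := k) (by rw [smul_pow, hk, smul_zero])]
    simp only [smul_pow, smul_smul]
  have hmem : (fun u => IsNilpotent.exp (-interaction J u + sourceTerm N)) ∈
      analyticFamily N u₀ := by
    simp only [hexp]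
    refine mul_mem_analyticFamily
      (g := fun u => ∑ n ∈ Finset.range k, ((n ! : ℂ)⁻¹ * (-(u / 24)) ^ n) • Q ^ n) ?_
      (const_mem_analyticFamily _)
    have h := (analyticFamily N u₀).sum_mem (t := Finset.range k)
      (f := fun n u => ((n ! : ℂ)⁻¹ * (-(u / 24)) ^ n) • Q ^ n)
      fun n _ => smul_mem_analyticFamily (by fun_prop) _
    convert! h using 1
    ext u
    rw [Finset.sum_apply]
  exact map_mem_analyticFamily ((body (berezin N (weight N)))⁻¹ •
    (berezin N * LinearMap.mulLeft ℂ (weight N))) hmem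

lemma analyticAt_partitionFunction : AnalyticAt ℂ (partitionFunction J) u₀ := by
  have h := analyticAt_of_mem_analyticFamily body.toLinearMap
    (sourcedPartitionFunction_mem J (u₀ := u₀))
  simpa only [AlgHom.toLinearMap_apply, body_sourcedPartitionFunction] using h

variable {J}

lemma analyticAt_freeEnergy (h : partitionFunction J u₀ ∈ Complex.slitPlane) :
    AnalyticAt ℂ (freeEnergy J) u₀ :=
  (analyticAt_partitionFunction J).clog h

lemma analyticAt_connectedCorrelation (h : partitionFunction J u₀ ∈ Complex.slitPlane) {n : ℕ}
    (a : Fin n → Mode N) : AnalyticAt ℂ (connectedCorrelation J a) u₀ := by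
  have hZ := analyticAt_partitionFunction J (u₀ := u₀)
  have hz := sourcedPartitionFunction_mem J (u₀ := u₀)
  have hlog : sourcedFreeEnergy J ∈ analyticFamily N u₀ := by
    have heq : sourcedFreeEnergy J = (fun u => freeEnergy J u • (1 : Grassmann N)) +
        ∑ k ∈ Finset.Icc 1 (4 * N), ((-1 : ℂ) ^ (k + 1) / (k : ℂ)) •
          ((fun u => (partitionFunction J u)⁻¹ • sourcedPartitionFunction J u) -
            fun _ => 1) ^ k := by
      ext u
      simp only [sourcedFreeEnergy, grassmannLog, body_sourcedPartitionFunction, freeEnergy,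
        Algebra.algebraMap_eq_smul_one, Pi.add_apply, Finset.sum_apply, Pi.smul_apply,
        Pi.pow_apply, Pi.sub_apply]
    rw [heq]
    refine Submodule.add_mem _ (smul_mem_analyticFamily (analyticAt_freeEnergy h) 1)
      (Submodule.sum_mem _ fun k _ => Submodule.smul_mem _ _ (pow_mem_analyticFamily ?_ k))
    exact Submodule.sub_mem _
      (fun_smul_mem_analyticFamily (hZ.inv (Complex.slitPlane_ne_zero h)) hz)
      (const_mem_analyticFamily 1)
  exact analyticAt_of_mem_analyticFamily
    (body.toLinearMap ∘ₗ (List.ofFn fun m => gderiv (Sum.inr (a m))).prod) hlog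

end Sources

end Majorana

end

theorem mainTheorem4 (N : ℕ) (J : Fin N → Fin N → Fin N → Fin N → ℝ)
    (hJ : Majorana.IsFermionicCoupling J) :
    ((∀ u ∈ interior (Majorana.cardioid J), Majorana.partitionFunction J u ≠ 0) ∧
      AnalyticOnNhd ℂ (Majorana.freeEnergy J) (interior (Majorana.cardioid J)) ∧
      Majorana.BorelSummable (Majorana.freeEnergy J)) ∧
    ∀ (n : ℕ) (a : Fin n → Majorana.Mode N),
      AnalyticOnNhd ℂ (Majorana.connectedCorrelation J a) (interior (Majorana.cardioid J)) ∧
      Majorana.BorelSummable (Majorana.connectedCorrelation J a) := by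
  have hslit : ∀ u ∈ interior (Majorana.cardioid J),
      Majorana.partitionFunction J u ∈ Complex.slitPlane := fun u hu =>
    Or.inl (Majorana.partitionFunction_re_pos hJ
      (Majorana.norm_le_of_mem_cardioid (interior_subset hu)))
  have hzero : Majorana.partitionFunction J 0 ∈ Complex.slitPlane :=
    Or.inl (Majorana.partitionFunction_re_pos hJ (by simp))
  exact ⟨⟨fun u hu => Complex.slitPlane_ne_zero (hslit u hu),
    fun u hu => Majorana.analyticAt_freeEnergy (hslit u hu),
    Majorana.borelSummable_of_analyticAt (Majorana.analyticAt_freeEnergy hzero)⟩,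
    fun n a => ⟨fun u hu => Majorana.analyticAt_connectedCorrelation (hslit u hu) a,
      Majorana.borelSummable_of_analyticAt (Majorana.analyticAt_connectedCorrelation hzero a)⟩⟩
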